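/- Let $G$ be a finite simple graph on $n$ nodes with maximum degree $d_{\max}$, and let $B_r(i)$ be the set of nodes at graph distance at most $r$ from node $i$. Let $\kappa$ be a restricted growth coefficient of $G$, i.e. $|B_{r+1}(i)|\le\kappa\,|B_r(i)|$ for all nodes $i$ and all integers $r\ge 1$. Let $0<p<1$. Consider the following randomized graph cluster randomization (RGCR) design. 1. (1-hop-max clustering) Draw independent $X_j\sim\mathcal U(0,1)$ for all nodes $j$ and put $c_i=\max\{X_j : j\in B_1(i)\}$; nodes with the same value $c_i$ form a cluster. 2. (cluster-level randomization) Given the clustering, with $K$ clusters, choose the set of treated clusters by one of two schemes. *Independent randomization*: each cluster is treated independently with probability $p$. *Complete randomization*: the number of treated clusters is $\lfloor pK\rfloor+1$ with probability $pK-\lfloor pK\rfloor$ and $\lfloor pK\rfloor$ otherwise (so it is exactly $pK$ when $pK$ is an integer, and each cluster is treated with probability $p$), and given this number all sets of clusters of that size are equally likely. Every node gets the treatment of its cluster, which gives a random treatment vector $\mathbf z\in\{0,1\}^n$. For $\mathbf b\in\{\mathbf 0,\mathbf 1\}$ let $E_i^{\mathbf b}$ be the event that node $i$ and all its neighbors have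 assignment $b$ (full-neighborhood exposure), and let $\mathbb P[E_i^{\mathbf b}\mid\mathcal P]$ be its probability under the whole design, with the clustering random. Let $Y_i(\mathbf z)$ be deterministic potential responses that satisfy the exposure model: $Y_i(\mathbf z)=Y_i(\mathbf b)$ whenever $\mathbf z\in E_i^{\mathbf b}$. Define the Horvitz–Thompson estimators $$\hat\mu_{\mathcal P}(\mathbf b)=\frac1n\sum_{i}\frac{\mathbf 1[E_i^{\mathbf b}]\,Y_i(\mathbf z)}{\mathbb P[E_i^{\mathbf b}\mid\mathcal P]},\qquad \hat\tau_{\mathcal P}=\hat\mu_{\mathcal P}(\mathbf 1)-\hat\mu_{\mathcal P}(\mathbf 0).$$ If all responses $Y_i(\mathbf z)$ lie in $[0,\bar Y]$, then $$\operatorname{Var}[\hat\tau_{\mathcal P}]\le\frac2n\,\bar Y^2(d_{\max}+1)^2\kappa^4\left(p^{-1}+(1-p)^{-1}\right),$$ for both independent and complete cluster-level randomization. -/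

import Mathlib

open MeasureTheory ProbabilityTheory

noncomputable section

namespace RGCR

variable {V : Type*} [Fintype V]

open Classical in
/-- The ball `B_r(i)`: all nodes at graph distance at most `r` from `i`
(`edist` is infinite between different components). -/
def ball (G : SimpleGraph V) (r : ℕ) (i : V) : Finset V :=
  Finset.univ.filter fun j => G.edist i j ≤ (r : ℕ∞)

theorem self_mem_ball (G : SimpleGraph V) (r : ℕ) (i : V) : i ∈ ball G r i := by
  simp [ball]

theorem ball_nonempty (G : SimpleGraph V) (r : ℕ) (i : V) : (ball G r i).Nonempty :=
  ⟨i, self_mem_ball G r i⟩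

/-- `κ` is a restricted growth coefficient of `G`:
`|B_{r+1}(i)| ≤ κ |B_r(i)|` for all nodes `i` and all radii `r ≥ 1`. -/
def RestrictedGrowth (G : SimpleGraph V) (κ : ℝ) : Prop :=
  ∀ (i : V) (r : ℕ), 1 ≤ r → ((ball G (r + 1) i).card : ℝ) ≤ κ * ((ball G r i).card : ℝ)

/-- The 1-hop-max clustering generated by the numbers `x`: node `i` gets the label
`max {x j | j ∈ B_1(i)}`; nodes with the same label form a cluster. -/
def oneHopMax (G : SimpleGraph V) (x : V → ℝ) (i : V) : ℝ :=
  (ball G 1 i).sup' (ball_nonempty G 1 i) x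

/-- The two cluster-level randomization schemes. -/
inductive Randomization
  | independent
  | complete

/-- The probability that, out of `K` clusters, the treated ones are exactly those in one given
set of `t` clusters (`t ≤ K`).

* `independent`: every cluster is treated independently with probability `p`.
* `complete`: the number of treated clusters is `p K`, rounded up with probability
  equal to the fractional part of `p K` and down otherwise (so that every cluster is treated
  with probability exactly `p`), and all sets of clusters of that size are equally likely. -/
def clusterWeight (p : ℝ) (K t : ℕ) : Randomization → ℝ
  | .independent => p ^ t * (1 - p) ^ (K - t)
  | .complete =>
      if t = ⌊p * K⌋₊ then (1 - Int.fract (p * K)) / (K.choose t : ℝ)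
      else if t = ⌊p * K⌋₊ + 1 then Int.fract (p * K) / (K.choose t : ℝ)
      else 0

open Classical in
/-- The law of the treatment vector `z : V → Bool` given the cluster labels `c`: clusters are
the values of `c`, a random set `T` of clusters is treated, and a node is treated when its
cluster is. -/
def assignmentLaw (R : Randomization) (p : ℝ) (c : V → ℝ) : Measure (V → Bool) :=
  ∑ T ∈ (Finset.univ.image c).powerset,
    ENNReal.ofReal (clusterWeight p (Finset.univ.image c).card T.card R) •
      Measure.dirac (fun i => decide (c i ∈ T))

theorem clusterWeight_nonneg {p : ℝ} (hp0 : 0 ≤ p) (hp1 : p ≤ 1) (K t : ℕ)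
    (R : Randomization) : 0 ≤ clusterWeight p K t R := by
  have h1 := Int.fract_nonneg (p * K)
  have h2 := (Int.fract_lt_one (p * K)).le
  cases R
  · exact mul_nonneg (pow_nonneg hp0 _) (pow_nonneg (by linarith) _)
  · simp only [clusterWeight]
    split_ifs
    · exact div_nonneg (by linarith) (Nat.cast_nonneg _)
    · exact div_nonneg h1 (Nat.cast_nonneg _)
    · exact le_rfl

/-- The weights of the sets of treated clusters add up to one. -/
theorem sum_clusterWeight {p : ℝ} (hp0 : 0 ≤ p) (hp1 : p ≤ 1) (C : Finset ℝ)
    (R : Randomization) : ∑ T ∈ C.powerset, clusterWeight p C.card T.card R = 1 := by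
  cases R
  · simp only [clusterWeight]
    rw [Finset.sum_pow_mul_eq_add_pow]
    simp
  · rw [Finset.sum_powerset_apply_card (fun t => clusterWeight p C.card t .complete)]
    set K := C.card
    have hK : (0 : ℝ) ≤ p * K := mul_nonneg hp0 (Nat.cast_nonneg _)
    have hle : p * K ≤ K := mul_le_of_le_one_left (Nat.cast_nonneg _) hp1
    have hm : ⌊p * K⌋₊ ≤ K := Nat.floor_le_of_le hle
    have hfr : Int.fract (p * K) = p * K - ⌊p * K⌋₊ := by
      rw [Int.fract, ← natCast_floor_eq_intCast_floor hK]
    have key : ∀ t ∈ Finset.range (K + 1),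
        K.choose t • clusterWeight p K t .complete =
          (if t = ⌊p * K⌋₊ then 1 - Int.fract (p * K) else 0) +
          (if t = ⌊p * K⌋₊ + 1 then Int.fract (p * K) else 0) := by
      intro t ht
      have hc : (K.choose t : ℝ) ≠ 0 := by
        have := Nat.choose_pos (Nat.lt_succ_iff.mp (Finset.mem_range.mp ht))
        positivity
      simp only [clusterWeight, nsmul_eq_mul]
      split_ifs with h1 h2
      · omega
      · field_simp; simp
      · field_simp; simp
      · simp
    rw [Finset.sum_congr rfl key, Finset.sum_add_distrib, Finset.sum_ite_eq',
      Finset.sum_ite_eq', if_pos (Finset.mem_range.mpr (by omega))]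
    split_ifs with h
    · ring
    · have hmK : ⌊p * K⌋₊ = K := by
        have : ¬ (⌊p * K⌋₊ + 1 < K + 1) := fun h' => h (Finset.mem_range.mpr h')
        omega
      have h3 := Nat.floor_le hK
      rw [hmK] at h3
      rw [hfr, hmK]
      linarith

theorem isProbabilityMeasure_assignmentLaw {p : ℝ} (hp0 : 0 ≤ p) (hp1 : p ≤ 1)
    (R : Randomization) (c : V → ℝ) : IsProbabilityMeasure (assignmentLaw R p c) := by
  constructor
  classical
  simp only [assignmentLaw, Measure.coe_finsetSum, Finset.sum_apply, Measure.smul_apply,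
    measure_univ, smul_eq_mul, mul_one]
  rw [← ENNReal.ofReal_sum_of_nonneg fun T _ => clusterWeight_nonneg hp0 hp1 _ _ R,
    sum_clusterWeight hp0 hp1, ENNReal.ofReal_one]

/-- The assignment law depends on the labels only through the partition. -/
theorem assignmentLaw_congr (R : Randomization) (p : ℝ) {c c' : V → ℝ}
    (h : ∀ i j, c i = c j ↔ c' i = c' j) : assignmentLaw R p c = assignmentLaw R p c' := by
  classical
  have hf : Function.FactorsThrough c' c := fun i j hij => (h i j).mp hij
  set g : ℝ → ℝ := Function.extend c c' 0
  have hg : ∀ i, g (c i) = c' i := fun i => hf.extend_apply 0 i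
  have hinj : Set.InjOn g (Finset.univ.image c : Finset ℝ) := by
    intro a ha b hb hab
    obtain ⟨i, -, rfl⟩ := Finset.mem_image.mp ha
    obtain ⟨j, -, rfl⟩ := Finset.mem_image.mp hb
    rw [hg, hg] at hab
    exact (h i j).mpr hab
  have himg : (Finset.univ.image c).image g = Finset.univ.image c' := by
    rw [Finset.image_image]
    exact Finset.image_congr fun i _ => hg i
  have hcard : (Finset.univ.image c).card = (Finset.univ.image c').card := by
    rw [← himg, Finset.card_image_of_injOn hinj]
  unfold assignmentLaw
  have hpow : (Finset.univ.image c').powerset =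
      (Finset.univ.image c).powerset.image (Finset.image g) := by
    rw [← himg]
    generalize Finset.univ.image c = C
    ext S
    simp [Finset.subset_image_iff]
  rw [hpow, Finset.sum_image, ← hcard]
  · refine Finset.sum_congr rfl fun T hT => ?_
    have hTs := Finset.mem_powerset.mp hT
    rw [Finset.card_image_of_injOn (hinj.mono (Finset.coe_subset.mpr hTs))]
    congr 2
    funext i
    rw [decide_eq_decide, ← hg]
    refine ⟨fun hi => Finset.mem_image_of_mem g hi, fun hi => ?_⟩
    obtain ⟨a, ha, hai⟩ := Finset.mem_image.mp hi
    rwa [← hinj (hTs ha) (Finset.mem_image_of_mem c (Finset.mem_univ i)) hai]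
  · intro S hS T hT hST
    have hS' := Finset.mem_powerset.mp hS
    have hT' := Finset.mem_powerset.mp hT
    have h2 : g '' (S : Set ℝ) = g '' (T : Set ℝ) := by
      rw [← Finset.coe_image, ← Finset.coe_image]
      exact congrArg _ hST
    exact Finset.coe_injective
      ((hinj.image_eq_image_iff (Finset.coe_subset.mpr hS') (Finset.coe_subset.mpr hT')).mp h2)

theorem measurable_assignmentLaw (R : Randomization) (p : ℝ) :
    Measurable (assignmentLaw R p : (V → ℝ) → Measure (V → Bool)) := by
  classical
  let r : (V → ℝ) → (V → V → Bool) := fun c i j => decide (c i = c j)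
  have hr : Measurable r := by
    refine measurable_pi_lambda _ fun i => measurable_pi_lambda _ fun j => ?_
    refine measurable_to_bool ?_
    have : (fun c : V → ℝ => r c i j) ⁻¹' {true} = {c | c i = c j} := by
      ext c; simp [r]
    rw [this]
    exact measurableSet_eq_fun (measurable_pi_apply i) (measurable_pi_apply j)
  have hfac : Function.FactorsThrough (assignmentLaw R p : (V → ℝ) → Measure (V → Bool)) r := by
    intro c c' hcc
    refine assignmentLaw_congr R p fun i j => ?_
    have := congrFun (congrFun hcc i) j
    simpa [r] using this
  have : (assignmentLaw R p : (V → ℝ) → Measure (V → Bool)) =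
      Function.extend r (assignmentLaw R p) 0 ∘ r := by
    funext c
    exact (hfac.extend_apply 0 c).symm
  rw [this]
  exact (measurable_of_finite _).comp hr

theorem measurable_oneHopMax (G : SimpleGraph V) : Measurable (oneHopMax G) := by
  refine measurable_pi_lambda _ fun i => ?_
  have := Finset.measurable_sup' (s := ball G 1 i) (ball_nonempty G 1 i)
    (f := fun j (x : V → ℝ) => x j) fun j _ => measurable_pi_apply j
  convert this using 1
  funext x
  exact (Finset.sup'_apply (C := fun _ : V → ℝ => ℝ) (ball_nonempty G 1 i)
    (fun j (x : V → ℝ) => x j) x).symm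

/-- The law of the random numbers: independent, each uniform on `(0, 1)`. -/
def seedLaw (V : Type*) [Fintype V] : Measure (V → ℝ) :=
  Measure.pi fun _ => (volume : Measure ℝ).restrict (Set.Ioo 0 1)

/-- The law of the treatment vector under randomized graph cluster randomization with
1-hop-max clustering: draw a random clustering, then randomize its clusters. -/
def designLaw (G : SimpleGraph V) (R : Randomization) (p : ℝ) : Measure (V → Bool) :=
  (seedLaw V).bind fun x => assignmentLaw R p (oneHopMax G x)

theorem isProbabilityMeasure_designLaw (G : SimpleGraph V) (R : Randomization) {p : ℝ}
    (hp0 : 0 ≤ p) (hp1 : p ≤ 1) : IsProbabilityMeasure (designLaw G R p) := by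
  have h01 : IsProbabilityMeasure ((volume : Measure ℝ).restrict (Set.Ioo 0 1)) :=
    ⟨by simp⟩
  have hs : IsProbabilityMeasure (seedLaw V) := by
    unfold seedLaw; infer_instance
  have hm := (measurable_assignmentLaw R p).comp (measurable_oneHopMax G)
  refine isProbabilityMeasure_bind hm.aemeasurable (ae_of_all _ fun x => ?_)
  exact isProbabilityMeasure_assignmentLaw hp0 hp1 R _

/-- The full-neighborhood exposure event `E_i^b`: node `i` and all its neighbors have
assignment `b` (`true` is treatment, `false` is control). -/
def exposure (G : SimpleGraph V) (b : Bool) (i : V) : Set (V → Bool) :=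
  {z | ∀ j ∈ ball G 1 i, z j = b}

/-- The full-neighborhood exposure model for the potential outcomes `Y i z`: an exposed node
responds as it would under the corresponding global assignment. -/
def ExposureModel (G : SimpleGraph V) (Y : V → (V → Bool) → ℝ) : Prop :=
  ∀ (b : Bool) (i : V), ∀ z ∈ exposure G b i, Y i z = Y i (fun _ => b)

open Classical in
/-- The Horvitz–Thompson estimator of the mean outcome under global assignment `b`,
as a function of the realized treatment vector `z`; the exposure probabilities are those of the
whole design, with the clustering random. -/
def htMean (G : SimpleGraph V) (R : Randomization) (p : ℝ) (Y : V → (V → Bool) → ℝ)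
    (b : Bool) (z : V → Bool) : ℝ :=
  (1 / (Fintype.card V : ℝ)) *
    ∑ i, (if z ∈ exposure G b i then Y i z / (designLaw G R p).real (exposure G b i) else 0)

/-- The Horvitz–Thompson estimator of the global average treatment effect. -/
def htGATE (G : SimpleGraph V) (R : Randomization) (p : ℝ) (Y : V → (V → Bool) → ℝ)
    (z : V → Bool) : ℝ :=
  htMean G R p Y true z - htMean G R p Y false z

end RGCR

end

/-! The variance is `n⁻²` times the sum of the covariances of the node contributions, so it suffices
to bound each row of the covariance matrix. Write `d = d_max + 1`, `Q = 1/p + 1/(1-p)`, and let `Δ =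
κ d` bound the 2-balls and `T = κ³ d` the 4-balls.

Near pairs: if `i` has the largest seed in `B_2(i)`, then `B_1(i)` lies in a single cluster. By
exchangeability this has probability at least `1/|B_2(i)|`, so exposure probabilities are at least
`p/Δ` and `(1-p)/Δ`, and any covariance is at most `Ybar² Δ Q` (`covariance_htTerm_le`).

Far pairs, `j ∉ B_4(i)`: the disjoint balls `B_2(i)` and `B_2(j)` determine how many clusters meet
`B_1(i)` and `B_1(j)`, and these clusters are distinct. Given the seeds, log-concavity of the
cluster weights makes equal exposures of `i` and `j` negatively correlated and opposite ones
positively correlated. As responses are nonnegative, the covariance is at most that of the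
conditional expectations given the seeds (`covariance_htTerm_le_cond`). With `K` clusters, `k` of
them meeting `B_1(i)`, the conditional probability of treated exposure lies between `p^k - O(1/K)`
and `p^k` (`InclusionSeq.le_pow`, `InclusionSeq.pow_sub_le`), and likewise for control. Only the
error depends on the global quantity `K`; the main terms at `i` and `j` are independent. Tracking
constants gives at most `Ybar² Δ Q/(K₀ - 1)` when there are almost surely at least `K₀ ≥ 2` clusters
(`covariance_htTerm_le_div`).

A cluster has at most `d` nodes, so `K₀ = ⌈n/d⌉` is allowed. At most `T` near pairs and `n ≤ K₀ T`
pairs in all then give the row bound `2 T Ybar² Δ Q`, and `T Δ = κ⁴ d²`. -/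

noncomputable section

namespace RGCR

section

/-! ### Strongly log-concave sequences and repeated Pascal sums -/

/-- A sequence without internal zeros whose consecutive ratios decrease. -/
def StrongLogConcave (a : ℕ → ℝ) : Prop :=
  ∀ i j, i ≤ j → a i * a (j + 2) ≤ a (i + 1) * a (j + 1)

/-- The `x`-fold iterate of the operator `a ↦ (j ↦ a j + a (j + 1))`. -/
def iterAdd (w : ℕ → ℝ) : ℕ → ℕ → ℝ
  | 0, j => w j
  | x + 1, j => iterAdd w x j + iterAdd w x (j + 1)

theorem iterAdd_nonneg {w : ℕ → ℝ} (hw : ∀ t, 0 ≤ w t) (x j : ℕ) : 0 ≤ iterAdd w x j := by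
  induction x generalizing j with
  | zero => exact hw j
  | succ x ih => exact add_nonneg (ih _) (ih _)

theorem StrongLogConcave.iterAdd {w : ℕ → ℝ} (hw : StrongLogConcave w) (x : ℕ) :
    StrongLogConcave (iterAdd w x) := by
  induction x with
  | zero => exact hw
  | succ x ih =>
    intro i j hij
    simp only [RGCR.iterAdd]
    have h1 := ih i j hij
    have h2 := ih i (j + 1) (by omega)
    have h4 := ih (i + 1) (j + 1) (by omega)
    -- Expanding both sides gives four products each, compared termwise. This pair is an equality
    -- when `i = j` and log-concavity at `(i + 1, j)` otherwise.
    have h3 : RGCR.iterAdd w x (i + 1) * RGCR.iterAdd w x (j + 2) ≤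
        RGCR.iterAdd w x (i + 2) * RGCR.iterAdd w x (j + 1) := by
      rcases hij.eq_or_lt with rfl | h
      · rw [mul_comm]
      · exact ih (i + 1) j h
    simp only [add_assoc, Nat.reduceAdd] at *
    nlinarith

/-- Splitting on whether one element of `A` is chosen is one Pascal step. Thus `iterAdd` computes
the probability of a pattern on `j` forced clusters when those of `A` are left free. -/
theorem sum_powerset_eq_iterAdd {α : Type*} (w : ℕ → ℝ) (A : Finset α) (j : ℕ) :
    ∑ U ∈ A.powerset, w (j + U.card) = iterAdd w A.card j := by
  classical
  induction A using Finset.induction_on generalizing j with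
  | empty => simp [iterAdd]
  | insert a A ha ih =>
    rw [Finset.sum_powerset_insert ha, Finset.card_insert_of_notMem ha]
    simp only [iterAdd]
    rw [ih, ← ih (j + 1)]
    congr 1
    refine Finset.sum_congr rfl fun U hU => ?_
    rw [Finset.card_insert_of_notMem fun h => ha (Finset.mem_powerset.mp hU h)]
    congr 1
    ring

theorem iterAdd_eq_sum (w : ℕ → ℝ) (x j : ℕ) :
    iterAdd w x j = ∑ i ∈ Finset.range (x + 1), (x.choose i : ℝ) * w (j + i) := by
  have h := sum_powerset_eq_iterAdd w (Finset.range x) j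
  rw [Finset.card_range, Finset.sum_powerset_apply_card (fun t => w (j + t)),
    Finset.card_range] at h
  rw [← h]
  simp

/-- The size of a random set of average size `p K` is positively correlated with
containing a given set. -/
theorem iterAdd_growth {w : ℕ → ℝ} {K : ℕ} {p : ℝ} (hw : ∀ t, 0 ≤ w t) (hp : 0 ≤ p)
    (hsum : ∑ t ∈ Finset.range (K + 1), (K.choose t : ℝ) * w t = 1)
    (hmean : ∑ t ∈ Finset.range (K + 1), (t : ℝ) * ((K.choose t : ℝ) * w t) = p * K)
    {k : ℕ} (hk : k + 1 ≤ K) :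
    iterAdd w (K - k) k * (p * K - k) ≤ iterAdd w (K - (k + 1)) (k + 1) * ((K : ℝ) - k) := by
  obtain ⟨x, rfl⟩ : ∃ x, K = k + 1 + x := ⟨K - (k + 1), by omega⟩
  have e1 : k + 1 + x - k = x + 1 := by omega
  have e2 : k + 1 + x - (k + 1) = x := by omega
  rw [e1, e2, iterAdd_eq_sum, iterAdd_eq_sum]
  set K := k + 1 + x with hK
  have hKx : (K : ℝ) - k = x + 1 := by rw [hK]; push_cast; ring
  have hright : (∑ i ∈ Finset.range (x + 1), (x.choose i : ℝ) * w (k + 1 + i)) * ((K : ℝ) - k) =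
      ∑ i ∈ Finset.range (x + 1 + 1), (i : ℝ) * (((x + 1).choose i : ℝ) * w (k + i)) := by
    rw [Finset.sum_range_succ' _ (x + 1), hKx, Finset.sum_mul]
    simp only [Nat.cast_zero, zero_mul, add_zero]
    refine Finset.sum_congr rfl fun i _ => ?_
    have := Nat.add_one_mul_choose_eq x i
    have h : ((x : ℝ) + 1) * x.choose i = (x + 1).choose (i + 1) * ((i : ℝ) + 1) := by
      exact_mod_cast this
    rw [show k + 1 + i = k + (i + 1) by ring]
    push_cast
    linear_combination w (k + (i + 1)) * h
  rw [hright, Finset.sum_mul, ← sub_nonneg, ← Finset.sum_sub_distrib]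
  -- Multiplied by `K.choose k`, the difference becomes `E[(N - pK) * N.choose k]`, where `N` is the
  -- size of the random set.
  have hck : (0 : ℝ) < K.choose k := by exact_mod_cast Nat.choose_pos (by omega)
  refine nonneg_of_mul_nonneg_right ?_ hck
  have hterm : ∀ i ∈ Finset.range (x + 1 + 1),
      (K.choose k : ℝ) * ((i : ℝ) * (((x + 1).choose i : ℝ) * w (k + i)) -
        ((x + 1).choose i : ℝ) * w (k + i) * (p * K - k)) =
      (((k + i : ℕ) : ℝ) - p * K) * ((k + i).choose k : ℝ) *
        ((K.choose (k + i) : ℝ) * w (k + i)) := by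
    intro i hi
    have hi' : i ≤ x + 1 := Nat.lt_succ_iff.mp (Finset.mem_range.mp hi)
    have := Nat.choose_mul (n := K) (k := k + i) (s := k) (by omega)
    rw [Nat.add_sub_cancel_left, e1] at this
    have h : (K.choose (k + i) : ℝ) * (k + i).choose k = K.choose k * (x + 1).choose i := by
      exact_mod_cast this
    push_cast
    linear_combination (-(w (k + i) * ((k : ℝ) + i - p * K))) * h
  rw [Finset.mul_sum, Finset.sum_congr rfl hterm]
  have hshift : ∑ i ∈ Finset.range (x + 1 + 1), (((k + i : ℕ) : ℝ) - p * K) *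
      ((k + i).choose k : ℝ) * ((K.choose (k + i) : ℝ) * w (k + i)) =
      ∑ t ∈ Finset.range (K + 1), ((t : ℝ) - p * K) * (t.choose k : ℝ) *
        ((K.choose t : ℝ) * w t) := by
    rw [show K + 1 = k + (x + 1 + 1) by omega, Finset.sum_range_add _ k (x + 1 + 1)]
    rw [Finset.sum_eq_zero (s := Finset.range k), zero_add]
    intro t ht
    rw [Nat.choose_eq_zero_of_lt (Finset.mem_range.mp ht)]
    simp
  rw [hshift]
  have hpK : (0 : ℝ) ≤ p * K := by positivity
  set m := ⌊p * K⌋₊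
  -- Since `N` has mean `pK`, the constant `m.choose k` may be subtracted from `N.choose k`. The
  -- integrand is then nonnegative pointwise because `t.choose k` is monotone in `t`.
  have hcenter : ∑ t ∈ Finset.range (K + 1), ((t : ℝ) - p * K) * (m.choose k : ℝ) *
      ((K.choose t : ℝ) * w t) = 0 := by
    have : ∀ t ∈ Finset.range (K + 1), ((t : ℝ) - p * K) * (m.choose k : ℝ) *
        ((K.choose t : ℝ) * w t) = (m.choose k : ℝ) * ((t : ℝ) * ((K.choose t : ℝ) * w t)) -
        (m.choose k : ℝ) * (p * K) * ((K.choose t : ℝ) * w t) := fun t _ => by ring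
    rw [Finset.sum_congr rfl this, Finset.sum_sub_distrib, ← Finset.mul_sum, ← Finset.mul_sum,
      hsum, hmean]
    ring
  rw [← hcenter]
  refine Finset.sum_le_sum fun t _ => ?_
  refine mul_le_mul_of_nonneg_right ?_ (mul_nonneg (Nat.cast_nonneg _) (hw t))
  rcases Nat.lt_or_ge m t with h | h
  · have h1 : p * K ≤ t := (Nat.lt_of_floor_lt h).le
    have h2 : (m.choose k : ℝ) ≤ t.choose k := by exact_mod_cast Nat.choose_le_choose k h.le
    exact mul_le_mul_of_nonneg_left h2 (by linarith)
  · have h1 : (t : ℝ) ≤ p * K := (Nat.cast_le.mpr h).trans (Nat.floor_le hpK)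
    have h2 : (t.choose k : ℝ) ≤ m.choose k := by exact_mod_cast Nat.choose_le_choose k h
    exact mul_le_mul_of_nonpos_left h2 (by linarith)

/-- `s k` behaves like the probability that `k` given elements out of `K` all belong to
a negatively dependent exchangeable random set with inclusion probability `p`. -/
structure InclusionSeq (p : ℝ) (K : ℕ) (s : ℕ → ℝ) : Prop where
  zero : s 0 = 1
  one : s 1 = p
  nonneg : ∀ k, 0 ≤ s k
  anti : ∀ k, k + 1 ≤ K → s (k + 1) ≤ s k
  logConcave : ∀ k, k + 2 ≤ K → s k * s (k + 2) ≤ s (k + 1) ^ 2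
  growth : ∀ k, k + 1 ≤ K → s k * (p * K - k) ≤ s (k + 1) * ((K : ℝ) - k)

/-! ### Bounds on inclusion probabilities: submultiplicativity and distance from powers -/

namespace InclusionSeq

variable {p : ℝ} {K : ℕ} {s : ℕ → ℝ}

/-- Log-concavity makes the ratios `s (k + 1) / s k` decrease. The form without division is needed
because complete randomization lets `s` vanish; monotonicity covers that case. -/
theorem succ_mul_le (h : InclusionSeq p K s) {k l : ℕ} (hlk : l ≤ k) (hk : k + 1 ≤ K) :
    s (k + 1) * s l ≤ s k * s (l + 1) := by
  induction k, hlk using Nat.le_induction with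
  | base => rw [mul_comm]
  | succ k hlk ih =>
    have ih := ih (by omega)
    rcases (h.nonneg k).eq_or_lt with h0 | h0
    · have h1 : s (k + 1) = 0 :=
        le_antisymm (h0 ▸ h.anti k (by omega)) (h.nonneg _)
      have h2 : s (k + 2) = 0 := le_antisymm (h1 ▸ h.anti (k + 1) hk) (h.nonneg _)
      rw [h1, h2]; simp
    · refine le_of_mul_le_mul_left ?_ h0
      have h1 := mul_le_mul_of_nonneg_right (h.logConcave k hk) (h.nonneg l)
      have h2 := mul_le_mul_of_nonneg_left ih (h.nonneg (k + 1))
      simp only [add_assoc, Nat.reduceAdd] at *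
      nlinarith

theorem add_le (h : InclusionSeq p K s) {k l : ℕ} (hk : k + l ≤ K) :
    s (k + l) ≤ s k * s l := by
  induction l with
  | zero => simp [h.zero]
  | succ l ih =>
    have ih := ih (by omega)
    have h1 := h.succ_mul_le (k := k + l) (l := l) (by omega) (by omega)
    rcases (h.nonneg l).eq_or_lt with h0 | h0
    · have h2 : s (k + l) = 0 :=
        le_antisymm (by rw [← h0, mul_zero] at ih; exact ih) (h.nonneg _)
      have h3 := h.anti (k + l) (by omega)
      rw [h2] at h3
      exact h3.trans (mul_nonneg (h.nonneg _) (h.nonneg _))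
    · refine le_of_mul_le_mul_right ?_ h0
      have h2 := mul_le_mul_of_nonneg_right ih (h.nonneg (l + 1))
      rw [← add_assoc]
      nlinarith

theorem le_pow (h : InclusionSeq p K s) {k : ℕ} (hk : k ≤ K) : s k ≤ p ^ k := by
  induction k with
  | zero => simp [h.zero]
  | succ k ih =>
    have hp : 0 ≤ p := h.one ▸ h.nonneg 1
    have h1 := h.add_le (k := k) (l := 1) hk
    rw [h.one] at h1
    rw [pow_succ]
    exact h1.trans (mul_le_mul_of_nonneg_right (ih (by omega)) hp)

/-- The growth inequality propagates a lower bound from `s i` to `s (i + 1)`, and the same error `E`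
survives every step. `hC1` is what `k = 2` requires, and `hC2` is what the step from `i` to `i + 1`
requires. -/
theorem pow_sub_le (h : InclusionSeq p K s) (hp0 : 0 < p) (hp1 : p < 1) (hK : 2 ≤ K) {C : ℝ}
    (hC1 : p * (1 - p) ^ 2 ≤ C) (hC2 : ∀ k : ℕ, 2 ≤ k → k * p ^ k * (1 - p) ≤ C)
    {k : ℕ} (hk : k ≤ K) : p ^ k - C / ((K - 1) * (1 - p)) ≤ s k := by
  have hK' : (2 : ℝ) ≤ K := by exact_mod_cast hK
  have hp' : 0 < 1 - p := by linarith
  have hC : 0 ≤ C := (by positivity : 0 ≤ p * (1 - p) ^ 2).trans hC1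
  have hden : 0 < ((K : ℝ) - 1) * (1 - p) := mul_pos (by linarith) hp'
  set E := C / (((K : ℝ) - 1) * (1 - p)) with hE
  have hE0 : 0 ≤ E := by positivity
  have hCE : C = E * ((K - 1) * (1 - p)) := by exact (div_mul_cancel₀ C hden.ne').symm
  have hcore : ∀ j : ℕ, j + 2 ≤ K → p ^ (j + 1 + 1) - E ≤ s (j + 1 + 1) := by
    intro j
    induction j with
    | zero =>
      intro h2
      have hg := h.growth 1 h2
      rw [h.one] at hg
      norm_num at hg ⊢
      have hpos : (0 : ℝ) < K - 1 := by linarith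
      refine le_of_mul_le_mul_right ?_ hpos
      have : p * (1 - p) ≤ E * (K - 1) := by
        refine le_of_mul_le_mul_right ?_ hp'
        nlinarith
      nlinarith
    | succ j ih =>
      intro h2
      have ih := ih (by omega)
      set i := j + 1 + 1 with hi
      have hiK : (i : ℝ) + 1 ≤ K := by exact_mod_cast (by omega : i + 1 ≤ K)
      have hg := h.growth i (by omega)
      have hci := hC2 i (by omega)
      have hsi := h.le_pow (k := i) (by omega)
      have hpi : 0 < p ^ i := pow_pos hp0 i
      rw [show j + 1 + 1 + 1 = i + 1 from rfl, pow_succ]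
      -- If `p K ≤ i`, growth gives nothing, but then `p ^ (i + 1) ≤ E` and the bound is trivial.
      -- Otherwise growth costs `i p ^ i (1 - p)`, while the factor `p K - i` in place of `K - i` on
      -- the old error saves `E K (1 - p)`, which is at least `C`.
      rcases le_or_gt (p * K) i with hcase | hcase
      · have h3 : p * K * p ^ i * (1 - p) ≤ C :=
          (mul_le_mul_of_nonneg_right (mul_le_mul_of_nonneg_right hcase hpi.le) hp'.le).trans hci
        have h4 : p ^ i * p ≤ E := by
          have hKp : 0 < (K : ℝ) * (1 - p) := by positivity
          refine le_of_mul_le_mul_right ?_ hKp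
          have : 0 ≤ E * (1 - p) := by positivity
          nlinarith
        have := h.nonneg (i + 1)
        linarith
      · have hpos : (0 : ℝ) < K - i := by linarith
        refine le_of_mul_le_mul_right ?_ hpos
        have h3 : (p ^ i - E) * (p * K - i) ≤ s i * (p * K - i) :=
          mul_le_mul_of_nonneg_right ih (by linarith)
        have h4 : 0 ≤ E * (1 - p) := by positivity
        nlinarith
  match k, hk with
  | 0, _ => rw [h.zero, pow_zero]; linarith
  | 1, _ => rw [h.one, pow_one]; linarith
  | j + 2, hk => exact hcore j hk

end InclusionSeq

/-! ### Numerical constants for the deficits -/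

theorem add_one_mul_pow_mul_le {n : ℕ} (hn : 2 ≤ n) {q : ℝ} (hq0 : 0 < q) :
    ((n : ℝ) + 1) * q ^ n * (1 - q) ≤ 4 / 9 := by
  have hn' : (2 : ℝ) ≤ n := by exact_mod_cast hn
  have hn0 : (0 : ℝ) < n := by linarith
  -- The left side is largest at `q = 1 / a`, with value `(a ^ n)⁻¹`. Bernoulli with exponent `n /
  -- 2` gives `a ^ (n / 2) ≥ 3 / 2`, hence `a ^ n ≥ 9 / 4`; this uses `n ≥ 2`. The substitution `r =
  -- q * a` moves the maximum to `r = 1`.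
  set a : ℝ := 1 + 1 / n with ha
  have ha0 : 0 < a := by positivity
  have han : 9 / 4 ≤ a ^ n := by
    have h1 := one_add_mul_self_le_rpow_one_add (s := 1 / (n : ℝ)) (p := (n : ℝ) / 2)
      (by have : (0 : ℝ) ≤ 1 / n := by positivity
          linarith) (by linarith)
    rw [← ha, show 1 + (n : ℝ) / 2 * (1 / n) = 3 / 2 by field_simp; norm_num] at h1
    have h2 : (a ^ ((n : ℝ) / 2)) ^ 2 = a ^ n := by
      rw [← Real.rpow_natCast (a ^ ((n : ℝ) / 2)), ← Real.rpow_mul ha0.le]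
      norm_num
    rw [← h2]
    nlinarith
  set r := q * a with hr
  have hr0 : 0 < r := by positivity
  have hb := one_add_mul_le_pow (a := 1 / r - 1)
    (by have : (0 : ℝ) < 1 / r := by positivity
        linarith) n
  rw [add_sub_cancel, one_div, inv_pow] at hb
  have hrr : 1 - r ≤ r⁻¹ - 1 := by
    have : 0 ≤ (r - 1) ^ 2 * r⁻¹ := by positivity
    have h2 : (r - 1) ^ 2 * r⁻¹ = r - 2 + r⁻¹ := by field_simp; ring
    linarith
  have h1 : ((n : ℝ) + 1) * (1 - q) ≤ (r ^ n)⁻¹ := by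
    have : ((n : ℝ) + 1) * (1 - q) = 1 + n * (1 - r) := by
      rw [hr, ha]; field_simp; ring
    rw [this]
    exact le_trans (by gcongr) hb
  have h2 : ((n : ℝ) + 1) * q ^ n * (1 - q) ≤ (a ^ n)⁻¹ := by
    calc ((n : ℝ) + 1) * q ^ n * (1 - q) = q ^ n * (((n : ℝ) + 1) * (1 - q)) := by ring
      _ ≤ q ^ n * (r ^ n)⁻¹ := by gcongr
      _ = (a ^ n)⁻¹ := by rw [hr, mul_pow]; field_simp
  refine h2.trans ?_
  rw [inv_le_comm₀ (by positivity) (by norm_num)]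
  norm_num
  exact han

/-- Constants that bound the deficits of the two treatment arms. -/
theorem exists_deficit_bounds {p : ℝ} (hp0 : 0 < p) (hp1 : p < 1) :
    ∃ C₁ C₀ : ℝ, C₁ + C₀ ≤ 1 / 2 ∧
      p * (1 - p) ^ 2 ≤ C₁ ∧ (∀ k : ℕ, 2 ≤ k → k * p ^ k * (1 - p) ≤ C₁) ∧
      (1 - p) * p ^ 2 ≤ C₀ ∧ (∀ k : ℕ, 2 ≤ k → k * (1 - p) ^ k * p ≤ C₀) := by
  have hlarge : ∀ q : ℝ, 0 < q → ∀ k : ℕ, 2 ≤ k →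
      k * q ^ k * (1 - q) ≤ max (2 * q ^ 2 * (1 - q)) (4 / 9 * q) := by
    intro q hq k hk
    obtain ⟨n, rfl⟩ : ∃ n, k = n + 1 := ⟨k - 1, by omega⟩
    rcases (show 1 ≤ n by omega).eq_or_lt with rfl | hn
    · refine le_max_of_le_left (le_of_eq ?_)
      norm_num
    · refine le_max_of_le_right ?_
      have := mul_le_mul_of_nonneg_right (add_one_mul_pow_mul_le hn hq) hq.le
      push_cast
      rw [pow_succ]
      linarith
  have hp' : 0 < 1 - p := by linarith
  -- The three entries cover the base case, `k = 2` and `k ≥ 3`. The budget `1 / 2` is attained at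
  -- `p = 1 / 2`, where `2 p ^ 2 (1 - p) + 2 (1 - p) ^ 2 p = 1 / 2`.
  refine ⟨max (p * (1 - p) ^ 2) (max (2 * p ^ 2 * (1 - p)) (4 / 9 * p)),
    max ((1 - p) * p ^ 2) (max (2 * (1 - p) ^ 2 * p) (4 / 9 * (1 - p))), ?_, le_max_left _ _,
    fun k hk => (hlarge p hp0 k hk).trans (le_max_right _ _), le_max_left _ _,
    fun k hk => ?_⟩
  · have hcub : ∀ x : ℝ, 0 < x → x < 1 → (1 - x) * x ^ 2 + 4 / 9 * x ≤ 1 / 2 := by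
      intro x h0 h1
      nlinarith [mul_nonneg h0.le (sq_nonneg (x - 5/6)), sq_nonneg (x - 5/6), mul_nonneg (sub_nonneg.2 h1.le) (sq_nonneg (x - 5/6))]
    have h1 := hcub p hp0 hp1
    have h2 := hcub (1 - p) hp' (by linarith)
    have h3 : p * (1 - p) ≤ 1 / 4 := by nlinarith [sq_nonneg (p - 1 / 2)]
    have h4 : p ^ 2 * (1 - p) ≤ 4 / 27 := by
      nlinarith [mul_nonneg hp0.le (sq_nonneg (p - 2/3)), sq_nonneg (p - 2/3)]
    have h5 : (1 - p) ^ 2 * p ≤ 4 / 27 := by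
      nlinarith [mul_nonneg hp'.le (sq_nonneg (p - 1/3)), sq_nonneg (p - 1/3)]
    rcases max_cases (p * (1 - p) ^ 2) (max (2 * p ^ 2 * (1 - p)) (4 / 9 * p)) with ⟨e, -⟩ | ⟨e, -⟩ <;>
    rcases max_cases (2 * p ^ 2 * (1 - p)) (4 / 9 * p) with ⟨e', -⟩ | ⟨e', -⟩ <;>
    rcases max_cases ((1 - p) * p ^ 2) (max (2 * (1 - p) ^ 2 * p) (4 / 9 * (1 - p))) with ⟨f, -⟩ | ⟨f, -⟩ <;>
    rcases max_cases (2 * (1 - p) ^ 2 * p) (4 / 9 * (1 - p)) with ⟨f', -⟩ | ⟨f', -⟩ <;>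
    rw [e, f] <;> (try rw [e']) <;> (try rw [f']) <;> nlinarith
  · have := hlarge (1 - p) hp' k hk
    rw [sub_sub_cancel] at this
    exact this.trans (le_max_right _ _)

end

section

/-! ### Inclusion probabilities of the cluster-level randomization -/

/-- The probability that `j` given clusters are treated and `l` given other clusters are not,
when a set of `t` out of `K` clusters is the treated one with probability `w t`. -/
def patternProb (w : ℕ → ℝ) (K j l : ℕ) : ℝ := iterAdd w (K - j - l) j

theorem patternProb_nonneg {w : ℕ → ℝ} (hw : ∀ t, 0 ≤ w t) (K j l : ℕ) :
    0 ≤ patternProb w K j l := iterAdd_nonneg hw _ _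

/-- One further cluster is either treated or not. -/
theorem patternProb_pascal (w : ℕ → ℝ) {K j l : ℕ} (h : j + l + 1 ≤ K) :
    patternProb w K j l = patternProb w K (j + 1) l + patternProb w K j (l + 1) := by
  obtain ⟨x, rfl⟩ : ∃ x, K = j + l + 1 + x := ⟨K - (j + l + 1), by omega⟩
  simp only [patternProb]
  rw [show j + l + 1 + x - j - l = x + 1 by omega,
    show j + l + 1 + x - (j + 1) - l = x by omega,
    show j + l + 1 + x - j - (l + 1) = x by omega, iterAdd, add_comm]

/-- With `a₀, a₁, a₂` the consecutive terms of `iterAdd w x` at `j`, the claim is `(a₁ + a₂)(a₀ +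
a₁) ≤ a₁ (a₀ + 2 a₁ + a₂)`, which is `a₀ a₂ ≤ a₁²`. -/
theorem patternProb_exchange {w : ℕ → ℝ} (hw : StrongLogConcave w) {K j l : ℕ}
    (h : j + l + 2 ≤ K) :
    patternProb w K (j + 1) l * patternProb w K j (l + 1) ≤
      patternProb w K (j + 1) (l + 1) * patternProb w K j l := by
  obtain ⟨x, rfl⟩ : ∃ x, K = j + l + 2 + x := ⟨K - (j + l + 2), by omega⟩
  simp only [patternProb]
  rw [show j + l + 2 + x - j - l = x + 1 + 1 by omega,
    show j + l + 2 + x - (j + 1) - l = x + 1 by omega,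
    show j + l + 2 + x - j - (l + 1) = x + 1 by omega,
    show j + l + 2 + x - (j + 1) - (l + 1) = x by omega]
  have := hw.iterAdd x j j le_rfl
  simp only [iterAdd]
  simp only [add_assoc, Nat.reduceAdd] at *
  nlinarith

/-- Positive correlation of opposite assignments. By the exchange inequality, the conditional
probability that one more cluster is untreated increases with the number of treated ones; `hchain`
compares it with none treated, and induction on `l` multiplies the comparisons. -/
theorem patternProb_mul_le {w : ℕ → ℝ} (hw0 : ∀ t, 0 ≤ w t) (hw : StrongLogConcave w) {K : ℕ}
    (hone : patternProb w K 0 0 = 1) {k l : ℕ} (h : k + l ≤ K) :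
    patternProb w K k 0 * patternProb w K 0 l ≤ patternProb w K k l := by
  have hnn := patternProb_nonneg hw0 K
  have hleft : ∀ j l, j + l + 1 ≤ K → patternProb w K (j + 1) l ≤ patternProb w K j l :=
    fun j l hjl => by
      have h1 := patternProb_pascal w hjl
      have h2 := hnn j (l + 1)
      linarith
  have hright : ∀ j l, j + l + 1 ≤ K → patternProb w K j (l + 1) ≤ patternProb w K j l :=
    fun j l hjl => by
      have h1 := patternProb_pascal w hjl
      have h2 := hnn (j + 1) l
      linarith
  have hchain : ∀ j l, j + l + 1 ≤ K → patternProb w K j l * patternProb w K 0 (l + 1) ≤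
      patternProb w K j (l + 1) * patternProb w K 0 l := by
    intro j l
    induction j with
    | zero => intro _; rw [mul_comm]
    | succ j ih =>
      intro hjl
      have ih := ih (by omega)
      have he := patternProb_exchange hw (K := K) (j := j) (l := l) (by omega)
      rcases (hnn j l).eq_or_lt with h0 | h0
      · have : patternProb w K (j + 1) l = 0 :=
          le_antisymm (h0 ▸ hleft j l (by omega)) (hnn _ _)
        rw [this, zero_mul]
        exact mul_nonneg (hnn _ _) (hnn _ _)
      · refine le_of_mul_le_mul_left ?_ h0
        have h1 := mul_le_mul_of_nonneg_left ih (hnn (j + 1) l)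
        have h2 := mul_le_mul_of_nonneg_right he (hnn 0 l)
        nlinarith
  induction l with
  | zero => rw [hone, mul_one]
  | succ l ih =>
    have ih := ih (by omega)
    have hc := hchain k l (by omega)
    rcases (hnn 0 l).eq_or_lt with h0 | h0
    · have : patternProb w K 0 (l + 1) = 0 :=
        le_antisymm (h0 ▸ hright 0 l (by omega)) (hnn _ _)
      rw [this, mul_zero]
      exact hnn _ _
    · refine le_of_mul_le_mul_right ?_ h0
      have h1 := mul_le_mul_of_nonneg_right ih (hnn 0 (l + 1))
      nlinarith

/-- Log-concavity is the exchange inequality at `l = 0`, with untreated clusters eliminated by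
Pascal's rule. -/
theorem inclusionSeq_of_weights {w : ℕ → ℝ} {K : ℕ} {p : ℝ} (hw0 : ∀ t, 0 ≤ w t)
    (hw : StrongLogConcave w) (hzero : patternProb w K 0 0 = 1) (hone : patternProb w K 1 0 = p)
    (hgrowth : ∀ k, k + 1 ≤ K → patternProb w K k 0 * (p * K - k) ≤
      patternProb w K (k + 1) 0 * ((K : ℝ) - k)) :
    InclusionSeq p K fun k => patternProb w K k 0 where
  zero := hzero
  one := hone
  nonneg k := patternProb_nonneg hw0 K k 0
  anti k hk := by
    have h1 := patternProb_pascal w (K := K) (j := k) (l := 0) (by omega)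
    have h2 := patternProb_nonneg hw0 K k 1
    simp only [zero_add] at *
    linarith
  logConcave k hk := by
    have h1 := patternProb_pascal w (K := K) (j := k) (l := 0) (by omega)
    have h2 := patternProb_pascal w (K := K) (j := k + 1) (l := 0) (by omega)
    have h3 := patternProb_exchange hw (K := K) (j := k) (l := 0) (by omega)
    simp only [zero_add, add_assoc, Nat.reduceAdd] at *
    have e1 := congrArg (patternProb w K k 0 * ·) h2
    have e2 := congrArg (patternProb w K (k + 1) 0 * ·) h1
    linarith
  growth := hgrowth

theorem inclusionSeq_control_of_weights {w : ℕ → ℝ} {K : ℕ} {p : ℝ} (hw0 : ∀ t, 0 ≤ w t)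
    (hw : StrongLogConcave w) (hzero : patternProb w K 0 0 = 1) (hone : patternProb w K 0 1 = p)
    (hgrowth : ∀ k, k + 1 ≤ K → patternProb w K 0 k * (p * K - k) ≤
      patternProb w K 0 (k + 1) * ((K : ℝ) - k)) :
    InclusionSeq p K fun k => patternProb w K 0 k where
  zero := hzero
  one := hone
  nonneg k := patternProb_nonneg hw0 K 0 k
  anti k hk := by
    have h1 := patternProb_pascal w (K := K) (j := 0) (l := k) (by omega)
    have h2 := patternProb_nonneg hw0 K 1 k
    simp only [zero_add] at *
    linarith
  logConcave k hk := by
    have h1 := patternProb_pascal w (K := K) (j := 0) (l := k) (by omega)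
    have h2 := patternProb_pascal w (K := K) (j := 0) (l := k + 1) (by omega)
    have h3 := patternProb_exchange hw (K := K) (j := 0) (l := k) (by omega)
    simp only [zero_add, add_assoc, Nat.reduceAdd] at *
    have e1 := congrArg (patternProb w K 0 k * ·) h2
    have e2 := congrArg (patternProb w K 0 (k + 1) * ·) h1
    linarith
  growth := hgrowth

/-- The untreated clusters form a random set with reflected weights, so results for treated sets
transfer to control. -/
theorem patternProb_control_eq_reflect (w : ℕ → ℝ) {K l : ℕ} (h : l ≤ K) :
    patternProb w K 0 l = patternProb (fun t => w (K - t)) K l 0 := by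
  simp only [patternProb, Nat.sub_zero]
  rw [iterAdd_eq_sum, iterAdd_eq_sum, ← Finset.sum_range_reflect]
  refine Finset.sum_congr rfl fun i hi => ?_
  have hi' : i ≤ K - l := Nat.lt_succ_iff.mp (Finset.mem_range.mp hi)
  rw [show K - l + 1 - 1 - i = K - l - i by omega, Nat.choose_symm hi']
  congr 2
  omega

theorem strongLogConcave_clusterWeight {p : ℝ} (hp0 : 0 ≤ p) (hp1 : p ≤ 1) (K : ℕ)
    (R : Randomization) : StrongLogConcave fun t => clusterWeight p K t R := by
  intro i j hij
  cases R
  · simp only [clusterWeight]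
    calc p ^ i * (1 - p) ^ (K - i) * (p ^ (j + 2) * (1 - p) ^ (K - (j + 2)))
        = p ^ (i + j + 2) * (1 - p) ^ ((K - i) + (K - (j + 2))) := by ring
      _ ≤ p ^ (i + j + 2) * (1 - p) ^ ((K - (i + 1)) + (K - (j + 1))) :=
          mul_le_mul_of_nonneg_left
            (pow_le_pow_of_le_one (by linarith) (by linarith) (by omega)) (pow_nonneg hp0 _)
      _ = _ := by ring
  · have hnn := fun t => clusterWeight_nonneg hp0 hp1 K t .complete
    -- The weights live on two consecutive sizes, while `i` and `j + 2` differ by at least two.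
    have h0 : clusterWeight p K i .complete * clusterWeight p K (j + 2) .complete = 0 := by
      simp only [clusterWeight]
      split_ifs <;> first | omega | simp
    change clusterWeight p K i .complete * clusterWeight p K (j + 2) .complete ≤ _
    rw [h0]
    exact mul_nonneg (hnn _) (hnn _)

theorem patternProb_clusterWeight_zero {p : ℝ} (hp0 : 0 ≤ p) (hp1 : p ≤ 1) (K : ℕ)
    (R : Randomization) : patternProb (fun t => clusterWeight p K t R) K 0 0 = 1 := by
  -- Any set of `K` real labels serves here, since the weights depend only on cardinalities.
  set C : Finset ℝ := (Finset.range K).map Nat.castEmbedding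
  have hC : C.card = K := by simp [C]
  have h1 := sum_clusterWeight hp0 hp1 C R
  have h2 := sum_powerset_eq_iterAdd (fun t => clusterWeight p K t R) C 0
  simp only [zero_add] at h2
  rw [hC] at h1 h2
  rw [patternProb, Nat.sub_zero, Nat.sub_zero, ← h2, h1]

theorem patternProb_independent (p : ℝ) {K j l : ℕ} (h : j + l ≤ K) :
    patternProb (fun t => clusterWeight p K t .independent) K j l = p ^ j * (1 - p) ^ l := by
  have key : ∀ x j, j + x ≤ K → iterAdd (fun t => clusterWeight p K t .independent) x j =
      p ^ j * (1 - p) ^ (K - j - x) := by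
    intro x
    induction x with
    | zero => intro j _; simp [iterAdd, clusterWeight]
    | succ x ih =>
      intro j hj
      rw [iterAdd, ih j (by omega), ih (j + 1) (by omega),
        show K - j - x = K - j - (x + 1) + 1 by omega,
        show K - (j + 1) - x = K - j - (x + 1) by omega]
      ring
  rw [patternProb, key _ _ (by omega)]
  congr 2
  omega

/-- Complete randomization treats `p K` clusters on average. -/
theorem mean_clusterWeight_complete {p : ℝ} (hp0 : 0 ≤ p) (hp1 : p ≤ 1) (K : ℕ) :
    ∑ t ∈ Finset.range (K + 1), (t : ℝ) * ((K.choose t : ℝ) * clusterWeight p K t .complete) =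
      p * K := by
  have hK : (0 : ℝ) ≤ p * K := mul_nonneg hp0 (Nat.cast_nonneg _)
  have hle : p * K ≤ K := mul_le_of_le_one_left (Nat.cast_nonneg _) hp1
  have hm : ⌊p * K⌋₊ ≤ K := Nat.floor_le_of_le hle
  have hfr : Int.fract (p * K) = p * K - ⌊p * K⌋₊ := by
    rw [Int.fract, ← natCast_floor_eq_intCast_floor hK]
  have key : ∀ t ∈ Finset.range (K + 1),
      (t : ℝ) * ((K.choose t : ℝ) * clusterWeight p K t .complete) =
        (if t = ⌊p * K⌋₊ then (t : ℝ) * (1 - Int.fract (p * K)) else 0) +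
        (if t = ⌊p * K⌋₊ + 1 then (t : ℝ) * Int.fract (p * K) else 0) := by
    intro t ht
    have hc : (K.choose t : ℝ) ≠ 0 := by
      have := Nat.choose_pos (Nat.lt_succ_iff.mp (Finset.mem_range.mp ht))
      positivity
    simp only [clusterWeight]
    split_ifs with h1 h2
    · omega
    · rw [mul_div_cancel₀ _ hc, add_zero]
    · rw [mul_div_cancel₀ _ hc, zero_add]
    · simp
  rw [Finset.sum_congr rfl key, Finset.sum_add_distrib, Finset.sum_ite_eq',
    Finset.sum_ite_eq', if_pos (Finset.mem_range.mpr (by omega)), hfr]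
  split_ifs with h
  · push_cast; ring
  · have hmK : ⌊p * K⌋₊ = K := by
      have : ¬ (⌊p * K⌋₊ + 1 < K + 1) := fun h' => h (Finset.mem_range.mpr h')
      omega
    have h3 := Nat.floor_le hK
    rw [hmK] at h3 ⊢
    have : p * K = K := le_antisymm hle h3
    rw [this]; ring

/-- Double counting: both sides are the expected number of treated clusters when `w` gives the
probabilities of the treated sets. -/
theorem mul_patternProb_one (w : ℕ → ℝ) {K : ℕ} (hK : 1 ≤ K) :
    (K : ℝ) * patternProb w K 1 0 =
      ∑ t ∈ Finset.range (K + 1), (t : ℝ) * ((K.choose t : ℝ) * w t) := by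
  obtain ⟨x, rfl⟩ : ∃ x, K = x + 1 := ⟨K - 1, by omega⟩
  rw [Finset.sum_range_succ' _ (x + 1), patternProb, Nat.sub_zero, Nat.add_sub_cancel,
    iterAdd_eq_sum, Finset.mul_sum]
  simp only [Nat.cast_zero, zero_mul, add_zero]
  refine Finset.sum_congr rfl fun i _ => ?_
  have h : ((x : ℝ) + 1) * x.choose i = (x + 1).choose (i + 1) * ((i : ℝ) + 1) := by
    exact_mod_cast Nat.add_one_mul_choose_eq x i
  rw [add_comm 1 i]
  push_cast
  linear_combination w (i + 1) * h

theorem inclusionSeq_treated {p : ℝ} (hp0 : 0 ≤ p) (hp1 : p ≤ 1) {K : ℕ} (hK : 1 ≤ K)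
    (R : Randomization) :
    InclusionSeq p K fun k => patternProb (fun t => clusterWeight p K t R) K k 0 := by
  have hw0 : ∀ t, 0 ≤ clusterWeight p K t R := fun t => clusterWeight_nonneg hp0 hp1 K t R
  have hz := patternProb_clusterWeight_zero hp0 hp1 K R
  refine inclusionSeq_of_weights hw0 (strongLogConcave_clusterWeight hp0 hp1 K R) hz ?_ ?_
  · cases R
    · rw [patternProb_independent p (by omega)]; simp
    · have h := mul_patternProb_one (fun t => clusterWeight p K t .complete) hK
      rw [mean_clusterWeight_complete hp0 hp1 K, mul_comm] at h
      exact mul_right_cancel₀ (by positivity) h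
  · intro k hk
    cases R
    · rw [patternProb_independent p (by omega), patternProb_independent p (by omega)]
      have h1 : 0 ≤ p ^ k * (k * (1 - p)) :=
        mul_nonneg (pow_nonneg hp0 _) (mul_nonneg (Nat.cast_nonneg _) (by linarith))
      rw [pow_succ]
      nlinarith
    · refine iterAdd_growth hw0 hp0 ?_ (mean_clusterWeight_complete hp0 hp1 K) hk
      rw [patternProb, iterAdd_eq_sum] at hz
      simpa using hz

theorem inclusionSeq_control {p : ℝ} (hp0 : 0 ≤ p) (hp1 : p ≤ 1) {K : ℕ} (hK : 1 ≤ K)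
    (R : Randomization) :
    InclusionSeq (1 - p) K fun k => patternProb (fun t => clusterWeight p K t R) K 0 k := by
  have hw0 : ∀ t, 0 ≤ clusterWeight p K t R := fun t => clusterWeight_nonneg hp0 hp1 K t R
  have hz := patternProb_clusterWeight_zero hp0 hp1 K R
  have hone := (inclusionSeq_treated hp0 hp1 hK R).one
  refine inclusionSeq_control_of_weights hw0 (strongLogConcave_clusterWeight hp0 hp1 K R) hz ?_ ?_
  · have := patternProb_pascal (fun t => clusterWeight p K t R) (K := K) (j := 0) (l := 0)
      (by omega)
    simp only [zero_add] at this
    linarith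
  · intro k hk
    cases R
    · rw [patternProb_independent p (by omega), patternProb_independent p (by omega)]
      have h1 : 0 ≤ (1 - p) ^ k * (k * p) :=
        mul_nonneg (pow_nonneg (by linarith) _) (mul_nonneg (Nat.cast_nonneg _) hp0)
      rw [pow_succ]
      nlinarith
    · rw [patternProb_control_eq_reflect _ (by omega), patternProb_control_eq_reflect _ hk]
      have hsum : ∑ t ∈ Finset.range (K + 1), (K.choose t : ℝ) *
          clusterWeight p K (K - t) .complete = 1 := by
        have h := hz
        rw [patternProb_control_eq_reflect _ (Nat.zero_le _), patternProb, iterAdd_eq_sum] at h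
        simpa using h
      refine iterAdd_growth (fun t => hw0 (K - t)) (by linarith) hsum ?_ hk
      have hm := mean_clusterWeight_complete hp0 hp1 K
      rw [← Finset.sum_range_reflect] at hm
      have : ∀ t ∈ Finset.range (K + 1), ((K + 1 - 1 - t : ℕ) : ℝ) *
          ((K.choose (K + 1 - 1 - t) : ℝ) * clusterWeight p K (K + 1 - 1 - t) .complete) =
          (K : ℝ) * ((K.choose t : ℝ) * clusterWeight p K (K - t) .complete) -
          (t : ℝ) * ((K.choose t : ℝ) * clusterWeight p K (K - t) .complete) := by
        intro t ht
        have ht' : t ≤ K := Nat.lt_succ_iff.mp (Finset.mem_range.mp ht)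
        rw [Nat.add_sub_cancel, Nat.choose_symm ht', Nat.cast_sub ht']
        ring
      rw [Finset.sum_congr rfl this, Finset.sum_sub_distrib, ← Finset.mul_sum, hsum] at hm
      linarith

variable {V : Type*} [Fintype V]

open Classical in
/-- Given the clusters, the probability that the nodes of `A` are treated and those of `B` are
not depends only on the numbers of clusters that meet `A` and `B`. -/
theorem assignmentLaw_real_pattern {p : ℝ} (hp0 : 0 ≤ p) (hp1 : p ≤ 1) (R : Randomization)
    (c : V → ℝ) (A B : Finset V) (hAB : Disjoint (A.image c) (B.image c)) :
    (assignmentLaw R p c).real {z | (∀ a ∈ A, z a = true) ∧ ∀ b ∈ B, z b = false} =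
      patternProb (fun t => clusterWeight p (Finset.univ.image c).card t R)
        (Finset.univ.image c).card (A.image c).card (B.image c).card := by
  set C := Finset.univ.image c with hC
  set w := fun t => clusterWeight p C.card t R with hw
  set S := A.image c with hS
  set S' := B.image c with hS'
  have hSC : S ⊆ C := Finset.image_subset_image (Finset.subset_univ _)
  have hSC' : S' ⊆ C := Finset.image_subset_image (Finset.subset_univ _)
  have h1 : (assignmentLaw R p c).real {z | (∀ a ∈ A, z a = true) ∧ ∀ b ∈ B, z b = false} =
      ∑ T ∈ C.powerset, if S ⊆ T ∧ Disjoint S' T then w T.card else 0 := by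
    simp only [Measure.real, assignmentLaw, Measure.coe_finsetSum, Finset.sum_apply,
      Measure.smul_apply, smul_eq_mul]
    rw [ENNReal.toReal_sum fun T _ => ENNReal.mul_ne_top ENNReal.ofReal_ne_top (by finiteness)]
    refine Finset.sum_congr rfl fun T _ => ?_
    rw [ENNReal.toReal_mul, ENNReal.toReal_ofReal (clusterWeight_nonneg hp0 hp1 _ _ R),
      Measure.dirac_apply' _ (Set.toFinite _).measurableSet]
    have hiff : (fun i => decide (c i ∈ T)) ∈
        {z : V → Bool | (∀ a ∈ A, z a = true) ∧ ∀ b ∈ B, z b = false} ↔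
        S ⊆ T ∧ Disjoint S' T := by
      simp [hS, hS', Finset.subset_iff, Finset.disjoint_left]
    by_cases h : S ⊆ T ∧ Disjoint S' T
    · rw [if_pos h, Set.indicator_of_mem (hiff.mpr h)]; simp [hw, hC]
    · rw [if_neg h, Set.indicator_of_notMem (fun h' => h (hiff.mp h'))]; simp
  rw [h1, ← Finset.sum_filter]
  have hcard : (C \ (S ∪ S')).card = C.card - S.card - S'.card := by
    rw [Finset.card_sdiff_of_subset (Finset.union_subset hSC hSC'),
      Finset.card_union_of_disjoint hAB]
    omega
  rw [patternProb, ← hcard, ← sum_powerset_eq_iterAdd]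
  symm
  -- An admissible treated set consists of `S` and an arbitrary subset of the clusters outside `S ∪
  -- S'`.
  refine Finset.sum_bij' (fun U _ => S ∪ U) (fun T _ => T \ S) ?_ ?_ ?_ ?_ ?_
  · intro U hU
    have hU' := Finset.mem_powerset.mp hU
    rw [Finset.mem_filter, Finset.mem_powerset]
    refine ⟨Finset.union_subset hSC (hU'.trans Finset.sdiff_subset),
      Finset.subset_union_left, ?_⟩
    rw [Finset.disjoint_union_right]
    refine ⟨hAB.symm, Finset.disjoint_left.mpr fun a ha haU => ?_⟩
    have := hU' haU
    simp [ha] at this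
  · intro T hT
    rw [Finset.mem_filter, Finset.mem_powerset] at hT
    obtain ⟨hTC, hST, hd⟩ := hT
    rw [Finset.mem_powerset]
    intro a ha
    rw [Finset.mem_sdiff] at ha
    rw [Finset.mem_sdiff, Finset.mem_union]
    exact ⟨hTC ha.1, fun h => h.elim ha.2 fun h => Finset.disjoint_left.mp hd h ha.1⟩
  · intro U hU
    have hd : Disjoint S U := Finset.disjoint_left.mpr fun a ha haU => by
      have := Finset.mem_powerset.mp hU haU
      simp [ha] at this
    rw [Finset.union_sdiff_left]
    exact Finset.sdiff_eq_self_of_disjoint hd.symm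
  · intro T hT
    rw [Finset.mem_filter] at hT
    exact Finset.union_sdiff_of_subset hT.2.1
  · intro U hU
    have hd : Disjoint S U := Finset.disjoint_left.mpr fun a ha haU => by
      have := Finset.mem_powerset.mp hU haU
      simp [ha] at this
    rw [Finset.card_union_of_disjoint hd]

end

section

/-! ### Balls -/

section Balls

variable {V : Type*} [Fintype V] {G : SimpleGraph V}

theorem mem_ball {r : ℕ} {i j : V} : j ∈ ball G r i ↔ G.edist i j ≤ (r : ℕ∞) := by
  simp [ball]

theorem mem_ball_comm {r : ℕ} {i j : V} : j ∈ ball G r i ↔ i ∈ ball G r j := by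
  rw [mem_ball, mem_ball, SimpleGraph.edist_comm]

theorem mem_ball_trans {r s : ℕ} {i j k : V} (hj : j ∈ ball G r i) (hk : k ∈ ball G s j) :
    k ∈ ball G (r + s) i := by
  rw [mem_ball] at *
  push_cast
  exact G.edist_triangle.trans (add_le_add hj hk)

theorem disjoint_ball {r s : ℕ} {i j : V} (h : j ∉ ball G (r + s) i) :
    Disjoint (ball G r i) (ball G s j) :=
  Finset.disjoint_left.mpr fun _ h1 h2 => h (mem_ball_trans h1 (mem_ball_comm.mp h2))

theorem card_ball_one_le [DecidableRel G.Adj] (i : V) :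
    (ball G 1 i).card ≤ G.maxDegree + 1 := by
  classical
  have hsub : ball G 1 i ⊆ insert i (G.neighborFinset i) := by
    intro j hj
    rw [mem_ball] at hj
    rw [Finset.mem_insert, SimpleGraph.mem_neighborFinset]
    by_cases hij : i = j
    · exact Or.inl hij.symm
    · refine Or.inr (SimpleGraph.edist_eq_one_iff_adj.mp (le_antisymm (by simpa using hj) ?_))
      exact Order.one_le_iff_pos.mpr (SimpleGraph.edist_pos_of_ne hij)
  refine (Finset.card_le_card hsub).trans ((Finset.card_insert_le _ _).trans ?_)
  rw [SimpleGraph.card_neighborFinset_eq_degree]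
  exact Nat.add_le_add_right (G.degree_le_maxDegree i) 1

theorem card_ball_pos (r : ℕ) (i : V) : 0 < (ball G r i).card :=
  Finset.card_pos.mpr (ball_nonempty G r i)

theorem RestrictedGrowth.one_le [Nonempty V] {κ : ℝ} (h : RestrictedGrowth G κ) : 1 ≤ κ := by
  obtain ⟨i⟩ := ‹Nonempty V›
  have h1 := h i 1 le_rfl
  have h2 : ((ball G 1 i).card : ℝ) ≤ (ball G (1 + 1) i).card := by
    refine Nat.cast_le.mpr (Finset.card_le_card fun j hj => ?_)
    exact mem_ball_trans hj (self_mem_ball G 1 j)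
  have h3 : (0 : ℝ) < (ball G 1 i).card := Nat.cast_pos.mpr (card_ball_pos 1 i)
  by_contra hlt
  push Not at hlt
  nlinarith

theorem RestrictedGrowth.card_ball_le [DecidableRel G.Adj] {κ : ℝ} (h : RestrictedGrowth G κ)
    (i : V) (r : ℕ) : ((ball G (r + 1) i).card : ℝ) ≤ κ ^ r * ((G.maxDegree : ℝ) + 1) := by
  have : Nonempty V := ⟨i⟩
  have hκ := h.one_le
  induction r with
  | zero => simpa using (by exact_mod_cast card_ball_one_le (G := G) i :
      ((ball G 1 i).card : ℝ) ≤ (G.maxDegree : ℝ) + 1)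
  | succ r ih =>
    refine (h i (r + 1) (by omega)).trans ?_
    rw [pow_succ', mul_assoc]
    exact mul_le_mul_of_nonneg_left ih (by linarith)

end Balls

/-! ### The 1-hop-max clustering of random seeds -/

variable {V : Type*}

open Classical in
/-- The number of labels that `c` takes on `A`. -/
def labelCount (c : V → ℝ) (A : Finset V) : ℕ := (A.image c).card

theorem labelCount_pos {c : V → ℝ} {A : Finset V} (hA : A.Nonempty) : 1 ≤ labelCount c A := by
  classical
  exact Finset.card_pos.mpr (hA.image c)

theorem labelCount_mono (c : V → ℝ) {A B : Finset V} (h : A ⊆ B) :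
    labelCount c A ≤ labelCount c B := by
  classical
  exact Finset.card_le_card (Finset.image_subset_image h)

variable [Fintype V]

theorem measurable_labelCount (A : Finset V) : Measurable fun c : V → ℝ => labelCount c A := by
  classical
  -- The count depends only on which labels coincide, and this pattern is a measurable function into
  -- a finite type.
  let r : (V → ℝ) → (V → V → Bool) := fun c i j => decide (c i = c j)
  have hr : Measurable r := by
    refine measurable_pi_lambda _ fun i => measurable_pi_lambda _ fun j => ?_
    refine measurable_to_bool ?_
    have : (fun c : V → ℝ => r c i j) ⁻¹' {true} = {c | c i = c j} := by
      ext c; simp [r]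
    rw [this]
    exact measurableSet_eq_fun (measurable_pi_apply i) (measurable_pi_apply j)
  have hfac : Function.FactorsThrough (fun c : V → ℝ => labelCount c A) r := by
    intro c c' hcc
    have h : ∀ i j, c i = c j ↔ c' i = c' j := fun i j => by
      simpa [r] using congrFun (congrFun hcc i) j
    have hf : Function.FactorsThrough c' c := fun i j hij => (h i j).mp hij
    have hg : ∀ i, Function.extend c c' 0 (c i) = c' i := fun i => hf.extend_apply 0 i
    have himg : (A.image c).image (Function.extend c c' 0) = A.image c' := by
      rw [Finset.image_image]
      exact Finset.image_congr fun i _ => hg i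
    change (A.image c).card = (A.image c').card
    have hinj : Set.InjOn (Function.extend c c' 0) (A.image c : Finset ℝ) := by
      intro a ha b hb hab
      obtain ⟨i, -, rfl⟩ := Finset.mem_image.mp ha
      obtain ⟨j, -, rfl⟩ := Finset.mem_image.mp hb
      rw [hg, hg] at hab
      exact (h i j).mpr hab
    have := Finset.card_image_of_injOn hinj
    rw [himg] at this
    exact this.symm
  have : (fun c : V → ℝ => labelCount c A) =
      Function.extend r (fun c : V → ℝ => labelCount c A) 0 ∘ r := by
    funext c
    exact (hfac.extend_apply 0 c).symm
  rw [this]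
  exact (measurable_of_finite _).comp hr

instance isProbabilityMeasure_uniform :
    IsProbabilityMeasure ((volume : Measure ℝ).restrict (Set.Ioo 0 1)) := ⟨by simp⟩

instance isProbabilityMeasure_seedLaw : IsProbabilityMeasure (seedLaw V) := by
  unfold seedLaw; infer_instance

/-- A tie between two given nodes confines the seeds to a proper subspace, which is Lebesgue null.
-/
theorem ae_injective_seedLaw : ∀ᵐ x ∂seedLaw V, Function.Injective x := by
  have hne : ∀ a b : V, a ≠ b → ∀ᵐ x ∂seedLaw V, x a ≠ x b := by
    classical
    intro a b hab
    rw [seedLaw, ← Measure.restrict_pi_pi, ← volume_pi]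
    refine ae_restrict_of_ae ?_
    let L : (V → ℝ) →ₗ[ℝ] ℝ := LinearMap.proj (R := ℝ) (φ := fun _ : V => ℝ) a - LinearMap.proj b
    have hL : LinearMap.ker L ≠ ⊤ := by
      intro h
      have : Pi.single a (1 : ℝ) ∈ LinearMap.ker L := h ▸ Submodule.mem_top
      simp [L, Pi.single_eq_of_ne hab.symm] at this
    have := Measure.addHaar_submodule (volume : Measure (V → ℝ)) _ hL
    rw [ae_iff]
    convert this using 2
    ext x
    simp [L, sub_eq_zero]
  have hall : ∀ᵐ x ∂seedLaw V, ∀ a b : V, a ≠ b → x a ≠ x b := by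
    rw [ae_all_iff]; intro a
    rw [ae_all_iff]; intro b
    by_cases hab : a = b
    · exact ae_of_all _ fun _ h => absurd hab h
    · filter_upwards [hne a b hab] with x hx _ using hx
  filter_upwards [hall] with x hx a b hab
  by_contra h
  exact hx a b h hab

theorem exists_oneHopMax_eq (G : SimpleGraph V) (x : V → ℝ) (a : V) :
    ∃ v ∈ ball G 1 a, oneHopMax G x a = x v :=
  Finset.exists_mem_eq_sup' (ball_nonempty G 1 a) x

open Classical in
-- Without ties a label identifies the node whose seed it is, and for a cluster meeting `B_1(i)`
-- that node lies in `B_2(i)`.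
theorem disjoint_labels {G : SimpleGraph V} {x : V → ℝ} (hx : Function.Injective x) {i j : V}
    (h : Disjoint (ball G 2 i) (ball G 2 j)) :
    Disjoint ((ball G 1 i).image (oneHopMax G x)) ((ball G 1 j).image (oneHopMax G x)) := by
  refine Finset.disjoint_left.mpr fun y h1 h2 => ?_
  obtain ⟨a, ha, rfl⟩ := Finset.mem_image.mp h1
  obtain ⟨b, hb, hab⟩ := Finset.mem_image.mp h2
  obtain ⟨v, hv, hav⟩ := exists_oneHopMax_eq G x a
  obtain ⟨w, hw, hbw⟩ := exists_oneHopMax_eq G x b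
  have hvw : w = v := hx (by rw [← hbw, ← hav, hab])
  subst hvw
  exact Finset.disjoint_left.mp h (mem_ball_trans ha hv) (mem_ball_trans hb hw)

/-- Every cluster lies in a ball of radius one, so there are at least `n / (d_max + 1)`. -/
theorem card_le_labelCount_mul {G : SimpleGraph V} [DecidableRel G.Adj] {x : V → ℝ}
    (hx : Function.Injective x) :
    Fintype.card V ≤ labelCount (oneHopMax G x) Finset.univ * (G.maxDegree + 1) := by
  classical
  rw [← Finset.card_univ, labelCount, mul_comm]
  refine Finset.card_le_mul_card_image _ _ fun y hy => ?_
  obtain ⟨a, -, rfl⟩ := Finset.mem_image.mp hy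
  obtain ⟨v, hv, hav⟩ := exists_oneHopMax_eq G x a
  refine (Finset.card_le_card fun b hb => ?_).trans (card_ball_one_le (G := G) v)
  obtain ⟨w, hw, hbw⟩ := exists_oneHopMax_eq G x b
  have : v = w := hx (by rw [← hav, ← hbw, (Finset.mem_filter.mp hb).2])
  exact mem_ball_comm.mp (this ▸ hw)

theorem labelCount_congr {G : SimpleGraph V} {x y : V → ℝ} {i : V}
    (h : ∀ v ∈ ball G 2 i, x v = y v) :
    labelCount (oneHopMax G x) (ball G 1 i) = labelCount (oneHopMax G y) (ball G 1 i) := by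
  classical
  unfold labelCount
  congr 1
  refine Finset.image_congr fun a ha => ?_
  exact Finset.sup'_congr _ rfl fun v hv => h v (mem_ball_trans ha hv)

theorem indepFun_labelCount {G : SimpleGraph V} {i j : V}
    (h : Disjoint (ball G 2 i) (ball G 2 j)) :
    IndepFun (fun x => labelCount (oneHopMax G x) (ball G 1 i))
      (fun x => labelCount (oneHopMax G x) (ball G 1 j)) (seedLaw V) := by
  classical
  -- Padding by `0` exhibits the count at `i` as a function of the seeds in `B_2(i)` alone; seeds
  -- elsewhere do not affect it.
  let ext : (A : Finset V) → (A → ℝ) → V → ℝ := fun A y v => if hv : v ∈ A then y ⟨v, hv⟩ else 0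
  have hext : ∀ A, Measurable (ext A) := fun A => by
    refine measurable_pi_lambda _ fun v => ?_
    by_cases hv : v ∈ A
    · simp only [ext, hv, dite_true]
      exact measurable_pi_apply _
    · simp only [ext, hv, dite_false]
      exact measurable_const
  have hind : IndepFun (fun (x : V → ℝ) (v : ball G 2 i) => x v)
      (fun (x : V → ℝ) (v : ball G 2 j) => x v) (seedLaw V) :=
    (iIndepFun_pi (X := fun (_ : V) (t : ℝ) => t) fun _ => aemeasurable_id).indepFun_finset
      _ _ h fun v => measurable_pi_apply v
  have hmeas : ∀ i, Measurable fun y : ball G 2 i → ℝ =>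
      labelCount (oneHopMax G (ext _ y)) (ball G 1 i) := fun i =>
    (measurable_labelCount _).comp ((measurable_oneHopMax G).comp (hext _))
  have hcomp := hind.comp (hmeas i) (hmeas j)
  have heq : ∀ i, ((fun y : ball G 2 i → ℝ =>
      labelCount (oneHopMax G (ext _ y)) (ball G 1 i)) ∘ fun (x : V → ℝ) (v : ball G 2 i) => x v) =
      fun x => labelCount (oneHopMax G x) (ball G 1 i) := fun i => by
    funext x
    exact labelCount_congr fun v hv => by simp [ext, hv]
  rwa [heq, heq] at hcomp

/-- Seeds are exchangeable, so a node has the largest seed in a set with probability at least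
the inverse of the size of the set. -/
theorem one_le_card_mul_seedLaw_max (B : Finset V) {i : V} (hi : i ∈ B) :
    1 ≤ (B.card : ℝ) * (seedLaw V).real {x | ∀ w ∈ B, x w ≤ x i} := by
  classical
  have hm : ∀ v, MeasurableSet {x : V → ℝ | ∀ w ∈ B, x w ≤ x v} := fun v => by
    have : {x : V → ℝ | ∀ w ∈ B, x w ≤ x v} = ⋂ w ∈ B, {x | x w ≤ x v} := by ext; simp
    rw [this]
    exact Finset.measurableSet_biInter _ fun w _ =>
      measurableSet_le (measurable_pi_apply w) (measurable_pi_apply v)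
  have hswap : ∀ v ∈ B, (seedLaw V).real {x | ∀ w ∈ B, x w ≤ x v} =
      (seedLaw V).real {x | ∀ w ∈ B, x w ≤ x i} := by
    intro v hv
    have hmp := measurePreserving_piCongrLeft
      (fun _ : V => (volume : Measure ℝ).restrict (Set.Ioo 0 1)) (Equiv.swap i v)
    have hpre := hmp.measure_preimage (hm v).nullMeasurableSet
    rw [Measure.real, Measure.real, seedLaw, ← hpre]
    congr 2
    ext x
    have hval : ∀ a, (MeasurableEquiv.piCongrLeft (fun _ : V => ℝ) (Equiv.swap i v)) x a =
        x (Equiv.swap i v a) := fun a => by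
      have := MeasurableEquiv.piCongrLeft_apply_apply (β := fun _ : V => ℝ) (Equiv.swap i v) x
        (Equiv.swap i v a)
      rwa [Equiv.swap_apply_self] at this
    have hB : ∀ w, Equiv.swap i v w ∈ B ↔ w ∈ B := fun w => by
      by_cases h1 : w = i
      · subst h1; simp [hi, hv]
      · by_cases h2 : w = v
        · subst h2; simp [hi, hv]
        · rw [Equiv.swap_apply_of_ne_of_ne h1 h2]
    simp only [Set.mem_preimage, Set.mem_ofPred_eq, hval, Equiv.swap_apply_right]
    refine ⟨fun h w hw => ?_, fun h w hw => h _ ((hB w).mpr hw)⟩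
    have := h (Equiv.swap i v w) ((hB w).mpr hw)
    rwa [Equiv.swap_apply_self] at this
  -- Some node of `B` attains the maximum. The union bound suffices, so ties need no exclusion.
  have hcover : (Set.univ : Set (V → ℝ)) ⊆ ⋃ v ∈ B, {x | ∀ w ∈ B, x w ≤ x v} := fun x _ => by
    obtain ⟨v, hv, hmax⟩ := B.exists_max_image x ⟨i, hi⟩
    exact Set.mem_biUnion (Finset.mem_coe.mpr hv) hmax
  calc (1 : ℝ) = (seedLaw V).real Set.univ := by simp
    _ ≤ (seedLaw V).real (⋃ v ∈ B, {x | ∀ w ∈ B, x w ≤ x v}) := measureReal_mono hcover (measure_ne_top _ _)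
    _ ≤ ∑ v ∈ B, (seedLaw V).real {x | ∀ w ∈ B, x w ≤ x v} :=
        measureReal_biUnion_finset_le _ _
    _ = _ := by rw [Finset.sum_congr rfl hswap]; simp

/-- Each neighbor `a` of `i` sees `i`, and all that it sees lies in `B_2(i)`, so its label is `x i`.
-/
theorem labelCount_eq_one {G : SimpleGraph V} {x : V → ℝ} {i : V}
    (h : ∀ w ∈ ball G 2 i, x w ≤ x i) : labelCount (oneHopMax G x) (ball G 1 i) = 1 := by
  classical
  refine Finset.card_eq_one.mpr ⟨x i, ?_⟩
  refine Finset.eq_singleton_iff_nonempty_unique_mem.mpr ⟨(ball_nonempty G 1 i).image _, ?_⟩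
  intro y hy
  obtain ⟨a, ha, rfl⟩ := Finset.mem_image.mp hy
  refine le_antisymm (Finset.sup'_le _ _ fun v hv => h v (mem_ball_trans ha hv)) ?_
  exact Finset.le_sup' x (mem_ball_comm.mp ha)

theorem one_le_card_mul_seedLaw_labelCount (G : SimpleGraph V) (i : V) :
    1 ≤ ((ball G 2 i).card : ℝ) *
      (seedLaw V).real {x | labelCount (oneHopMax G x) (ball G 1 i) = 1} :=
  (one_le_card_mul_seedLaw_max _ (self_mem_ball G 2 i)).trans
    (mul_le_mul_of_nonneg_left (measureReal_mono fun _ hx => labelCount_eq_one hx)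
      (Nat.cast_nonneg _))

end

section

/-! ### Covariance estimates -/

section Covariance

variable {Ω : Type*} [MeasurableSpace Ω] {μ : Measure Ω}

theorem memLp_contrast {X X' : Ω → ℝ} (hX : MemLp X 2 μ) (hX' : MemLp X' 2 μ) (a b : ℝ) :
    MemLp (fun ω => a * X ω - b * X' ω) 2 μ :=
  (hX.const_mul a).sub (hX'.const_mul b)

variable [IsProbabilityMeasure μ]

theorem covariance_contrast {X X' Y Y' : Ω → ℝ} (hX : MemLp X 2 μ) (hX' : MemLp X' 2 μ)
    (hY : MemLp Y 2 μ) (hY' : MemLp Y' 2 μ) (a b c d : ℝ) :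
    cov[fun ω => a * X ω - b * X' ω, fun ω => c * Y ω - d * Y' ω; μ] =
      a * c * cov[X, Y; μ] - a * d * cov[X, Y'; μ] - b * c * cov[X', Y; μ] +
        b * d * cov[X', Y'; μ] := by
  rw [covariance_fun_sub_fun_sub (hX.const_mul a) (hX'.const_mul b) (hY.const_mul c)
    (hY'.const_mul d)]
  simp only [covariance_const_mul_left, covariance_const_mul_right]
  ring

/-- A contrast of nonnegative variables with means at most one has a small covariance with
a variable of small range. -/
theorem covariance_contrast_le_range {a b h : Ω → ℝ} (ha : MemLp a 2 μ) (hb : MemLp b 2 μ)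
    (hh : MemLp h 2 μ) (ha0 : ∀ᵐ ω ∂μ, 0 ≤ a ω) (hb0 : ∀ᵐ ω ∂μ, 0 ≤ b ω)
    (ha1 : ∫ ω, a ω ∂μ ≤ 1) (hb1 : ∫ ω, b ω ∂μ ≤ 1) {lo hi M α β : ℝ}
    (hlo : ∀ᵐ ω ∂μ, lo ≤ h ω) (hhi : ∀ᵐ ω ∂μ, h ω ≤ hi)
    (hα : α ∈ Set.Icc 0 M) (hβ : β ∈ Set.Icc 0 M) :
    cov[fun ω => α * a ω - β * b ω, h; μ] ≤ M * (hi - lo) := by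
  have hM : 0 ≤ M := hα.1.trans hα.2
  have hhi1 : Integrable h μ := hh.integrable (by norm_num)
  have hai : Integrable a μ := ha.integrable (by norm_num)
  have hbi : Integrable b μ := hb.integrable (by norm_num)
  set m := ∫ ω, h ω ∂μ with hm
  have hm1 : lo ≤ m := by
    have := integral_mono_ae (integrable_const lo) hhi1 hlo
    simpa using this
  have hm2 : m ≤ hi := by
    have := integral_mono_ae hhi1 (integrable_const hi) hhi
    simpa using this
  have hc := memLp_contrast ha hb α β
  have hci : Integrable (fun ω => α * a ω - β * b ω) μ := hc.integrable (by norm_num)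
  have hprod : Integrable (fun ω => (α * a ω - β * b ω) * (h ω - m)) μ :=
    hc.integrable_mul (hh.sub (memLp_const m))
  have hcov : cov[fun ω => α * a ω - β * b ω, h; μ] =
      ∫ ω, (α * a ω - β * b ω) * (h ω - m) ∂μ := by
    rw [covariance_eq_sub hc hh]
    have hp2 : Integrable (fun ω => (α * a ω - β * b ω) * h ω) μ := hc.integrable_mul hh
    have : ∀ ω, (α * a ω - β * b ω) * (h ω - m) =
        (α * a ω - β * b ω) * h ω - (α * a ω - β * b ω) * m := fun ω => by ring
    simp only [this]
    rw [integral_sub hp2 (hci.mul_const m), integral_mul_const]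
    rfl
  rw [hcov]
  -- The two terms use opposite deviations of `h` from its mean, at most `hi - m` upward and `m -
  -- lo` downward. They add up to a single range.
  calc ∫ ω, (α * a ω - β * b ω) * (h ω - m) ∂μ
      ≤ ∫ ω, (α * (hi - m) * a ω + β * (m - lo) * b ω) ∂μ := by
        refine integral_mono_ae hprod ((hai.const_mul _).add (hbi.const_mul _)) ?_
        filter_upwards [ha0, hb0, hlo, hhi] with ω h1 h2 h3 h4
        have e1 := mul_le_mul_of_nonneg_left (by linarith : h ω - m ≤ hi - m)
          (mul_nonneg hα.1 h1)
        have e2 := mul_le_mul_of_nonneg_left (by linarith : m - h ω ≤ m - lo)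
          (mul_nonneg hβ.1 h2)
        nlinarith
    _ = α * (hi - m) * ∫ ω, a ω ∂μ + β * (m - lo) * ∫ ω, b ω ∂μ := by
        rw [integral_add (hai.const_mul _) (hbi.const_mul _), integral_const_mul,
          integral_const_mul]
    _ ≤ M * (hi - m) * 1 + M * (m - lo) * 1 := by
        refine add_le_add ?_ ?_
        · refine mul_le_mul (mul_le_mul_of_nonneg_right hα.2 (by linarith)) ha1
            (integral_nonneg_of_ae ha0) (mul_nonneg hM (by linarith))
        · refine mul_le_mul (mul_le_mul_of_nonneg_right hβ.2 (by linarith)) hb1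
            (integral_nonneg_of_ae hb0) (mul_nonneg hM (by linarith))
    _ = M * (hi - lo) := by ring

/-- Contrasts of variables that are well approximated from below by independent ones are
nearly uncorrelated. -/
theorem covariance_contrast_le_of_approx {A a B b : Bool → Ω → ℝ} {α β r s : Bool → ℝ} {M : ℝ}
    (hA : ∀ t, MemLp (A t) 2 μ) (ha : ∀ t, MemLp (a t) 2 μ)
    (hB : ∀ t, MemLp (B t) 2 μ) (hb : ∀ t, MemLp (b t) 2 μ)
    (ha0 : ∀ t, ∀ᵐ ω ∂μ, 0 ≤ a t ω) (haA : ∀ t, ∀ᵐ ω ∂μ, a t ω ≤ A t ω)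
    (hAr : ∀ t, ∀ᵐ ω ∂μ, A t ω ≤ a t ω + r t)
    (hb0 : ∀ t, ∀ᵐ ω ∂μ, 0 ≤ b t ω) (hbB : ∀ t, ∀ᵐ ω ∂μ, b t ω ≤ B t ω)
    (hBs : ∀ t, ∀ᵐ ω ∂μ, B t ω ≤ b t ω + s t)
    (hA1 : ∀ t, ∫ ω, A t ω ∂μ ≤ 1) (hB1 : ∀ t, ∫ ω, B t ω ∂μ ≤ 1)
    (hα : ∀ t, α t ∈ Set.Icc 0 M) (hβ : ∀ t, β t ∈ Set.Icc 0 M)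
    (hind : ∀ t t', cov[a t, b t'; μ] = 0) :
    cov[fun ω => α true * A true ω - α false * A false ω,
        fun ω => β true * B true ω - β false * B false ω; μ] ≤
      M ^ 2 * ((r true + r false) + (s true + s false)) := by
  -- The approximation error of a contrast has range at most `M * (r true + r false)`: each arm
  -- contributes on one side only.
  have hgap : ∀ {A a : Bool → Ω → ℝ} {α r : Bool → ℝ}, (∀ t, MemLp (A t) 2 μ) →
      (∀ t, MemLp (a t) 2 μ) → (∀ t, ∀ᵐ ω ∂μ, a t ω ≤ A t ω) →
      (∀ t, ∀ᵐ ω ∂μ, A t ω ≤ a t ω + r t) → (∀ t, α t ∈ Set.Icc 0 M) →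
      MemLp (fun ω => α true * (A true ω - a true ω) - α false * (A false ω - a false ω)) 2 μ ∧
      (∀ᵐ ω ∂μ, -(M * r false) ≤
        α true * (A true ω - a true ω) - α false * (A false ω - a false ω)) ∧
      (∀ᵐ ω ∂μ, α true * (A true ω - a true ω) - α false * (A false ω - a false ω) ≤
        M * r true) := by
    intro A a α r hA ha haA hAr hα
    refine ⟨memLp_contrast ((hA true).sub (ha true)) ((hA false).sub (ha false)) _ _, ?_, ?_⟩
    · filter_upwards [haA true, haA false, hAr false] with ω h1 h2 h3
      have e1 := mul_nonneg (hα true).1 (sub_nonneg.mpr h1)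
      have e2 := mul_le_mul (hα false).2 (sub_le_iff_le_add'.mpr h3) (sub_nonneg.mpr h2)
        ((hα false).1.trans (hα false).2)
      linarith
    · filter_upwards [haA true, haA false, hAr true] with ω h1 h2 h3
      have e1 := mul_nonneg (hα false).1 (sub_nonneg.mpr h2)
      have e2 := mul_le_mul (hα true).2 (sub_le_iff_le_add'.mpr h3) (sub_nonneg.mpr h1)
        ((hα true).1.trans (hα true).2)
      linarith
  obtain ⟨hLA, hloA, hhiA⟩ := hgap hA ha haA hAr hα
  obtain ⟨hLB, hloB, hhiB⟩ := hgap hB hb hbB hBs hβ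
  have hA0 : ∀ t, ∀ᵐ ω ∂μ, 0 ≤ A t ω := fun t => by
    filter_upwards [ha0 t, haA t] with ω h1 h2 using h1.trans h2
  have hb1 : ∀ t, ∫ ω, b t ω ∂μ ≤ 1 := fun t =>
    (integral_mono_ae ((hb t).integrable (by norm_num)) ((hB t).integrable (by norm_num))
      (hbB t)).trans (hB1 t)
  have hf := memLp_contrast (hA true) (hA false) (α true) (α false)
  have hg := memLp_contrast (ha true) (ha false) (α true) (α false)
  have hg' := memLp_contrast (hb true) (hb false) (β true) (β false)
  have e1 : (fun ω => β true * B true ω - β false * B false ω) =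
      (fun ω => β true * b true ω - β false * b false ω) +
      fun ω => β true * (B true ω - b true ω) - β false * (B false ω - b false ω) := by
    funext ω; simp only [Pi.add_apply]; ring
  have e2 : (fun ω => α true * A true ω - α false * A false ω) =
      (fun ω => α true * a true ω - α false * a false ω) +
      fun ω => α true * (A true ω - a true ω) - α false * (A false ω - a false ω) := by
    funext ω; simp only [Pi.add_apply]; ring
  have c1 := covariance_contrast_le_range (hA true) (hA false) hLB (hA0 true) (hA0 false)
    (hA1 true) (hA1 false) hloB hhiB (hα true) (hα false)
  have c2 := covariance_contrast_le_range (hb true) (hb false) hLA (hb0 true) (hb0 false)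
    (hb1 true) (hb1 false) hloA hhiA (hβ true) (hβ false)
  have c3 : cov[fun ω => α true * a true ω - α false * a false ω,
      fun ω => β true * b true ω - β false * b false ω; μ] = 0 := by
    rw [covariance_contrast (ha true) (ha false) (hb true) (hb false)]
    simp [hind]
  rw [covariance_comm] at c2
  -- `cov(F, H) = cov(f, h) + cov(F - f, h) + cov(F, H - h)`, where `f, h` are the approximating
  -- contrasts. The first term vanishes, and each of the others pairs an error of small range with a
  -- contrast of nonnegative variables of mean at most one.
  rw [e1, covariance_add_right hf hg' hLB]
  conv_lhs => arg 1; rw [e2]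
  rw [covariance_add_left hg hLA hg', c3]
  linarith

end Covariance

end

section

/-! ### Exposure probabilities -/

/-- The probability that a cluster gets assignment `b`. -/
def armProb (p : ℝ) (b : Bool) : ℝ := if b then p else 1 - p

theorem armProb_pos {p : ℝ} (hp0 : 0 < p) (hp1 : p < 1) (b : Bool) : 0 < armProb p b := by
  cases b <;> simp [armProb, hp0, hp1]

theorem armProb_lt_one {p : ℝ} (hp0 : 0 < p) (hp1 : p < 1) (b : Bool) : armProb p b < 1 := by
  cases b <;> simp [armProb, hp0, hp1]

/-- The probability that `k` given clusters out of `K` all get assignment `b`. -/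
def armSeq (R : Randomization) (p : ℝ) (K : ℕ) (b : Bool) (k : ℕ) : ℝ :=
  if b then patternProb (fun t => clusterWeight p K t R) K k 0
  else patternProb (fun t => clusterWeight p K t R) K 0 k

theorem inclusionSeq_armSeq {p : ℝ} (hp0 : 0 ≤ p) (hp1 : p ≤ 1) {K : ℕ} (hK : 1 ≤ K)
    (R : Randomization) (b : Bool) : InclusionSeq (armProb p b) K (armSeq R p K b) := by
  cases b
  · exact inclusionSeq_control hp0 hp1 hK R
  · exact inclusionSeq_treated hp0 hp1 hK R

variable {V : Type*} [Fintype V]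

/-- The conditional probability of `E_i^b` given the seeds. -/
def condExposure (G : SimpleGraph V) (R : Randomization) (p : ℝ) (b : Bool) (i : V)
    (x : V → ℝ) : ℝ :=
  (assignmentLaw R p (oneHopMax G x)).real (exposure G b i)

/-- The probability of `E_i^b` under the whole design. -/
def exposureProb (G : SimpleGraph V) (R : Randomization) (p : ℝ) (b : Bool) (i : V) : ℝ :=
  (designLaw G R p).real (exposure G b i)

theorem measurable_assignmentLaw_real (G : SimpleGraph V) (R : Randomization) (p : ℝ) (E : Set (V → Bool)) :
    Measurable fun x => (assignmentLaw R p (oneHopMax G x)).real E :=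
  (((Measure.measurable_coe (Set.toFinite E).measurableSet).comp
    (measurable_assignmentLaw R p)).comp (measurable_oneHopMax G)).ennreal_toReal

theorem assignmentLaw_real_le_one {p : ℝ} (hp0 : 0 ≤ p) (hp1 : p ≤ 1)
    (R : Randomization) (c : V → ℝ) (E : Set (V → Bool)) :
    (assignmentLaw R p c).real E ≤ 1 := by
  have := isProbabilityMeasure_assignmentLaw hp0 hp1 R c
  exact measureReal_le_one

theorem memLp_assignmentLaw_real {p : ℝ} (hp0 : 0 ≤ p) (hp1 : p ≤ 1)
    (G : SimpleGraph V) (R : Randomization) (E : Set (V → Bool)) :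
    MemLp (fun x => (assignmentLaw R p (oneHopMax G x)).real E) 2 (seedLaw V) := by
  refine MemLp.of_bound (measurable_assignmentLaw_real G R p E).aestronglyMeasurable 1
    (ae_of_all _ fun x => ?_)
  rw [Real.norm_of_nonneg measureReal_nonneg]
  exact assignmentLaw_real_le_one hp0 hp1 R _ E

theorem integrable_assignmentLaw_real {p : ℝ} (hp0 : 0 ≤ p) (hp1 : p ≤ 1)
    (G : SimpleGraph V) (R : Randomization) (E : Set (V → Bool)) :
    Integrable (fun x => (assignmentLaw R p (oneHopMax G x)).real E) (seedLaw V) :=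
  (memLp_assignmentLaw_real hp0 hp1 G R E).integrable (by norm_num)

theorem designLaw_real {p : ℝ} (hp0 : 0 ≤ p) (hp1 : p ≤ 1)
    (G : SimpleGraph V) (R : Randomization) (E : Set (V → Bool)) :
    (designLaw G R p).real E =
      ∫ x, (assignmentLaw R p (oneHopMax G x)).real E ∂seedLaw V := by
  have hE : MeasurableSet E := (Set.toFinite E).measurableSet
  have hm : Measurable fun x => assignmentLaw R p (oneHopMax G x) :=
    (measurable_assignmentLaw R p).comp (measurable_oneHopMax G)
  rw [Measure.real, designLaw]
  rw [Measure.bind_apply hE hm.aemeasurable]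
  simp only [Measure.real]
  refine (integral_toReal (f := fun x => assignmentLaw R p (oneHopMax G x) E)
    ((Measure.measurable_coe hE).comp hm).aemeasurable ?_).symm
  refine ae_of_all _ fun x => ?_
  have := isProbabilityMeasure_assignmentLaw hp0 hp1 R (oneHopMax G x)
  exact measure_lt_top _ _

theorem exposureProb_eq_integral {p : ℝ} (hp0 : 0 ≤ p) (hp1 : p ≤ 1)
    (G : SimpleGraph V) (R : Randomization) (b : Bool) (i : V) :
    exposureProb G R p b i = ∫ x, condExposure G R p b i x ∂seedLaw V :=
  designLaw_real hp0 hp1 G R _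

theorem condExposure_eq {p : ℝ} (hp0 : 0 ≤ p) (hp1 : p ≤ 1)
    (G : SimpleGraph V) (R : Randomization) (b : Bool) (i : V) (x : V → ℝ) :
    condExposure G R p b i x = armSeq R p (labelCount (oneHopMax G x) Finset.univ) b
      (labelCount (oneHopMax G x) (ball G 1 i)) := by
  classical
  cases b
  · have := assignmentLaw_real_pattern hp0 hp1 R (oneHopMax G x) ∅ (ball G 1 i) (by simp)
    simp only [Finset.notMem_empty, false_imp_iff, implies_true, true_and, Finset.image_empty,
      Finset.card_empty] at this
    simp only [armSeq, Bool.false_eq_true, if_false, labelCount]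
    convert this
    rfl
  · have := assignmentLaw_real_pattern hp0 hp1 R (oneHopMax G x) (ball G 1 i) ∅ (by simp)
    simp only [Finset.notMem_empty, false_imp_iff, implies_true, and_true, Finset.image_empty,
      Finset.card_empty] at this
    simp only [armSeq, if_true, labelCount]
    convert this
    rfl

/-- The two neighborhoods meet disjoint sets of clusters, so their counts add and
submultiplicativity of the inclusion probabilities applies. -/
theorem condExposure_inter_same_le {p : ℝ} (hp0 : 0 ≤ p) (hp1 : p ≤ 1)
    (G : SimpleGraph V) (R : Randomization) {x : V → ℝ} (hx : Function.Injective x) {i j : V}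
    (h : Disjoint (ball G 2 i) (ball G 2 j)) (b : Bool) :
    (assignmentLaw R p (oneHopMax G x)).real (exposure G b i ∩ exposure G b j) ≤
      condExposure G R p b i x * condExposure G R p b j x := by
  classical
  rw [condExposure_eq hp0 hp1, condExposure_eq hp0 hp1]
  set c := oneHopMax G x
  set U := ball G 1 i ∪ ball G 1 j with hU
  have hsplit : labelCount c U = labelCount c (ball G 1 i) + labelCount c (ball G 1 j) := by
    simp only [labelCount, hU]
    rw [Finset.image_union, Finset.card_union_of_disjoint]
    convert disjoint_labels hx h
  have hinter : (assignmentLaw R p c).real (exposure G b i ∩ exposure G b j) =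
      armSeq R p (labelCount c Finset.univ) b (labelCount c U) := by
    cases b
    · have := assignmentLaw_real_pattern hp0 hp1 R c ∅ U (by simp)
      simp only [Finset.notMem_empty, false_imp_iff, implies_true, true_and, Finset.image_empty,
        Finset.card_empty] at this
      simp only [armSeq, Bool.false_eq_true, if_false, labelCount]
      convert this using 2
      ext z
      simp only [exposure, Set.mem_inter_iff, Set.mem_ofPred_eq, hU, Finset.mem_union]
      exact ⟨fun h k hk => hk.elim (h.1 k) (h.2 k),
        fun h => ⟨fun k hk => h k (.inl hk), fun k hk => h k (.inr hk)⟩⟩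
    · have := assignmentLaw_real_pattern hp0 hp1 R c U ∅ (by simp)
      simp only [Finset.notMem_empty, false_imp_iff, implies_true, and_true, Finset.image_empty,
        Finset.card_empty] at this
      simp only [armSeq, if_true, labelCount]
      convert this using 2
      ext z
      simp only [exposure, Set.mem_inter_iff, Set.mem_ofPred_eq, hU, Finset.mem_union]
      exact ⟨fun h k hk => hk.elim (h.1 k) (h.2 k),
        fun h => ⟨fun k hk => h k (.inl hk), fun k hk => h k (.inr hk)⟩⟩
  rw [hinter, hsplit]
  refine (inclusionSeq_armSeq hp0 hp1 ?_ R b).add_le ?_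
  · exact labelCount_pos ⟨i, Finset.mem_univ i⟩
  · rw [← hsplit]
    exact labelCount_mono c (Finset.subset_univ _)

theorem condExposure_mul_le_inter {p : ℝ} (hp0 : 0 ≤ p) (hp1 : p ≤ 1)
    (G : SimpleGraph V) (R : Randomization) {x : V → ℝ} (hx : Function.Injective x) {i j : V}
    (h : Disjoint (ball G 2 i) (ball G 2 j)) :
    condExposure G R p true i x * condExposure G R p false j x ≤
      (assignmentLaw R p (oneHopMax G x)).real (exposure G true i ∩ exposure G false j) := by
  classical
  rw [condExposure_eq hp0 hp1, condExposure_eq hp0 hp1]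
  set c := oneHopMax G x
  have hd : Disjoint ((ball G 1 i).image c) ((ball G 1 j).image c) := by
    convert disjoint_labels hx h
  have hsplit : labelCount c (ball G 1 i ∪ ball G 1 j) =
      labelCount c (ball G 1 i) + labelCount c (ball G 1 j) := by
    simp only [labelCount]
    rw [Finset.image_union, Finset.card_union_of_disjoint]
    convert hd
  have hinter := assignmentLaw_real_pattern hp0 hp1 R c (ball G 1 i) (ball G 1 j)
    (by convert hd)
  have heq : (assignmentLaw R p c).real (exposure G true i ∩ exposure G false j) =
      patternProb (fun t => clusterWeight p (labelCount c Finset.univ) t R)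
        (labelCount c Finset.univ) (labelCount c (ball G 1 i)) (labelCount c (ball G 1 j)) :=
    hinter
  rw [heq]
  refine patternProb_mul_le (fun t => clusterWeight_nonneg hp0 hp1 _ t R)
    (strongLogConcave_clusterWeight hp0 hp1 _ R) (patternProb_clusterWeight_zero hp0 hp1 _ R) ?_
  rw [← hsplit]
  exact labelCount_mono c (Finset.subset_univ _)

/-- With probability at least `1 / |B_2(i)|` the neighborhood lies in one cluster, and then a single
cluster assignment decides exposure. -/
theorem armProb_le_card_mul_exposureProb {p : ℝ} (hp0 : 0 ≤ p) (hp1 : p ≤ 1)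
    (G : SimpleGraph V) (R : Randomization) (b : Bool) (i : V) :
    armProb p b ≤ ((ball G 2 i).card : ℝ) * exposureProb G R p b i := by
  have hq : 0 ≤ armProb p b := by cases b <;> simp [armProb, hp0, hp1]
  have hset : MeasurableSet {x : V → ℝ | labelCount (oneHopMax G x) (ball G 1 i) = 1} :=
    ((measurable_labelCount _).comp (measurable_oneHopMax G)) (measurableSet_singleton 1)
  have h1 : armProb p b *
      (seedLaw V).real {x | labelCount (oneHopMax G x) (ball G 1 i) = 1} ≤
      exposureProb G R p b i := by
    rw [exposureProb_eq_integral hp0 hp1, mul_comm, ← smul_eq_mul,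
      ← integral_indicator_const _ hset]
    refine integral_mono_of_nonneg (ae_of_all _ fun x => Set.indicator_nonneg (fun _ _ => hq) x)
      (integrable_assignmentLaw_real hp0 hp1 G R _) (ae_of_all _ fun x => ?_)
    by_cases hx : labelCount (oneHopMax G x) (ball G 1 i) = 1
    · rw [Set.indicator_of_mem (by exact hx)]
      change _ ≤ condExposure G R p b i x
      rw [condExposure_eq hp0 hp1, hx,
        (inclusionSeq_armSeq hp0 hp1 (labelCount_pos ⟨i, Finset.mem_univ i⟩) R b).one]
    · rw [Set.indicator_of_notMem (by exact hx)]
      exact measureReal_nonneg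
  have h2 := one_le_card_mul_seedLaw_labelCount G i
  have h3 := mul_le_mul_of_nonneg_left h1 (Nat.cast_nonneg (α := ℝ) (ball G 2 i).card)
  nlinarith

end

section

variable {V : Type*} [Fintype V]

/-! ### The Horvitz–Thompson estimator -/

/-- The indicator of `E_i^b` divided by its probability. -/
def htWeight (G : SimpleGraph V) (R : Randomization) (p : ℝ) (b : Bool) (i : V) :
    (V → Bool) → ℝ :=
  (exposure G b i).indicator fun _ => (exposureProb G R p b i)⁻¹

/-- The conditional expectation of `htWeight` given the seeds. -/
def condWeight (G : SimpleGraph V) (R : Randomization) (p : ℝ) (b : Bool) (i : V)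
    (x : V → ℝ) : ℝ :=
  (exposureProb G R p b i)⁻¹ * condExposure G R p b i x

/-- The contribution of node `i` to `n` times the Horvitz–Thompson estimator. -/
def htTerm (G : SimpleGraph V) (R : Randomization) (p : ℝ) (Y : V → (V → Bool) → ℝ) (i : V)
    (z : V → Bool) : ℝ :=
  Y i (fun _ => true) * htWeight G R p true i z - Y i (fun _ => false) * htWeight G R p false i z

theorem htGATE_eq (G : SimpleGraph V) (R : Randomization) (p : ℝ) {Y : V → (V → Bool) → ℝ}
    (hmodel : ExposureModel G Y) :
    htGATE G R p Y = fun z => (1 / (Fintype.card V : ℝ)) * ∑ i, htTerm G R p Y i z := by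
  classical
  have hmean : ∀ b z, htMean G R p Y b z =
      (1 / (Fintype.card V : ℝ)) * ∑ i, Y i (fun _ => b) * htWeight G R p b i z := by
    intro b z
    rw [htMean]
    congr 1
    refine Finset.sum_congr rfl fun i _ => ?_
    by_cases hz : z ∈ exposure G b i
    · rw [if_pos hz, htWeight, Set.indicator_of_mem hz, hmodel b i z hz, div_eq_mul_inv,
        exposureProb]
    · rw [if_neg hz, htWeight, Set.indicator_of_notMem hz, mul_zero]
  funext z
  rw [htGATE, hmean, hmean, ← mul_sub, ← Finset.sum_sub_distrib]
  rfl

theorem exposureProb_pos {p : ℝ} (hp0 : 0 < p) (hp1 : p < 1) (G : SimpleGraph V)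
    (R : Randomization) (b : Bool) (i : V) : 0 < exposureProb G R p b i := by
  have h1 := armProb_le_card_mul_exposureProb hp0.le hp1.le G R b i
  have h2 := armProb_pos hp0 hp1 b
  exact pos_of_mul_pos_right (h2.trans_le h1) (Nat.cast_nonneg _)

theorem exposureProb_le_one {p : ℝ} (hp0 : 0 ≤ p) (hp1 : p ≤ 1) (G : SimpleGraph V)
    (R : Randomization) (b : Bool) (i : V) : exposureProb G R p b i ≤ 1 := by
  have := isProbabilityMeasure_designLaw G R hp0 hp1
  exact measureReal_le_one

theorem covariance_htWeight {p : ℝ} (hp0 : 0 < p) (hp1 : p < 1) (G : SimpleGraph V)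
    (R : Randomization) (b b' : Bool) (i j : V) :
    cov[htWeight G R p b i, htWeight G R p b' j; designLaw G R p] =
      (exposureProb G R p b i)⁻¹ * (exposureProb G R p b' j)⁻¹ *
        (designLaw G R p).real (exposure G b i ∩ exposure G b' j) - 1 := by
  have := isProbabilityMeasure_designLaw G R hp0.le hp1.le
  have hint : ∀ b i, ∫ z, htWeight G R p b i z ∂designLaw G R p = 1 := fun b i => by
    rw [htWeight, integral_indicator_const _ (Set.toFinite _).measurableSet, smul_eq_mul]
    exact mul_inv_cancel₀ (exposureProb_pos hp0 hp1 G R b i).ne'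
  have hprod : htWeight G R p b i * htWeight G R p b' j =
      (exposure G b i ∩ exposure G b' j).indicator fun _ =>
        (exposureProb G R p b i)⁻¹ * (exposureProb G R p b' j)⁻¹ := by
    funext z
    simp only [htWeight, Pi.mul_apply, Set.inter_indicator_mul]
  rw [covariance_eq_sub MemLp.of_discrete MemLp.of_discrete, hint, hint, hprod,
    integral_indicator_const _ (Set.toFinite _).measurableSet, smul_eq_mul]
  ring

theorem memLp_condWeight {p : ℝ} (hp0 : 0 ≤ p) (hp1 : p ≤ 1) (G : SimpleGraph V)
    (R : Randomization) (b : Bool) (i : V) : MemLp (condWeight G R p b i) 2 (seedLaw V) :=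
  (memLp_assignmentLaw_real hp0 hp1 G R _).const_mul _

theorem integral_condWeight {p : ℝ} (hp0 : 0 < p) (hp1 : p < 1) (G : SimpleGraph V)
    (R : Randomization) (b : Bool) (i : V) : ∫ x, condWeight G R p b i x ∂seedLaw V = 1 := by
  simp only [condWeight]
  rw [integral_const_mul, ← exposureProb_eq_integral hp0.le hp1.le]
  exact inv_mul_cancel₀ (exposureProb_pos hp0 hp1 G R b i).ne'

theorem covariance_condWeight {p : ℝ} (hp0 : 0 < p) (hp1 : p < 1) (G : SimpleGraph V)
    (R : Randomization) (b b' : Bool) (i j : V) :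
    cov[condWeight G R p b i, condWeight G R p b' j; seedLaw V] =
      (exposureProb G R p b i)⁻¹ * (exposureProb G R p b' j)⁻¹ *
        (∫ x, condExposure G R p b i x * condExposure G R p b' j x ∂seedLaw V) - 1 := by
  rw [covariance_eq_sub (memLp_condWeight hp0.le hp1.le G R b i)
    (memLp_condWeight hp0.le hp1.le G R b' j), integral_condWeight hp0 hp1,
    integral_condWeight hp0 hp1, ← integral_const_mul, mul_one]
  congr 2
  funext x
  simp only [Pi.mul_apply, condWeight]
  ring

theorem covariance_htWeight_same_le {p : ℝ} (hp0 : 0 < p) (hp1 : p < 1) (G : SimpleGraph V)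
    (R : Randomization) (b : Bool) {i j : V} (h : Disjoint (ball G 2 i) (ball G 2 j)) :
    cov[htWeight G R p b i, htWeight G R p b j; designLaw G R p] ≤
      cov[condWeight G R p b i, condWeight G R p b j; seedLaw V] := by
  rw [covariance_htWeight hp0 hp1, covariance_condWeight hp0 hp1,
    designLaw_real hp0.le hp1.le]
  have h1 := exposureProb_pos hp0 hp1 G R b i
  have h2 := exposureProb_pos hp0 hp1 G R b j
  refine sub_le_sub_right (mul_le_mul_of_nonneg_left ?_ (by positivity)) 1
  refine integral_mono_ae (integrable_assignmentLaw_real hp0.le hp1.le G R _)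
    ((memLp_assignmentLaw_real hp0.le hp1.le G R _).integrable_mul
      (memLp_assignmentLaw_real hp0.le hp1.le G R _)) ?_
  filter_upwards [ae_injective_seedLaw] with x hx
  exact condExposure_inter_same_le hp0.le hp1.le G R hx h b

theorem covariance_condWeight_le {p : ℝ} (hp0 : 0 < p) (hp1 : p < 1) (G : SimpleGraph V)
    (R : Randomization) {i j : V} (h : Disjoint (ball G 2 i) (ball G 2 j)) :
    cov[condWeight G R p true i, condWeight G R p false j; seedLaw V] ≤
      cov[htWeight G R p true i, htWeight G R p false j; designLaw G R p] := by
  rw [covariance_htWeight hp0 hp1, covariance_condWeight hp0 hp1,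
    designLaw_real hp0.le hp1.le]
  have h1 := exposureProb_pos hp0 hp1 G R true i
  have h2 := exposureProb_pos hp0 hp1 G R false j
  refine sub_le_sub_right (mul_le_mul_of_nonneg_left ?_ (by positivity)) 1
  refine integral_mono_ae ((memLp_assignmentLaw_real hp0.le hp1.le G R _).integrable_mul
      (memLp_assignmentLaw_real hp0.le hp1.le G R _))
    (integrable_assignmentLaw_real hp0.le hp1.le G R _) ?_
  filter_upwards [ae_injective_seedLaw] with x hx
  exact condExposure_mul_le_inter hp0.le hp1.le G R hx h

/-- Cross-arm covariances enter with a minus sign. Negative correlation within an arm and positive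
correlation across arms therefore push the same way, provided the responses are nonnegative. -/
theorem covariance_htTerm_le_cond {p : ℝ} (hp0 : 0 < p) (hp1 : p < 1) (G : SimpleGraph V)
    (R : Randomization) {Y : V → (V → Bool) → ℝ} (hY : ∀ i z, 0 ≤ Y i z) {i j : V}
    (h : Disjoint (ball G 2 i) (ball G 2 j)) :
    cov[htTerm G R p Y i, htTerm G R p Y j; designLaw G R p] ≤
      cov[fun x => Y i (fun _ => true) * condWeight G R p true i x -
          Y i (fun _ => false) * condWeight G R p false i x,
        fun x => Y j (fun _ => true) * condWeight G R p true j x -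
          Y j (fun _ => false) * condWeight G R p false j x; seedLaw V] := by
  have := isProbabilityMeasure_designLaw G R hp0.le hp1.le
  have hm := memLp_condWeight hp0.le hp1.le G R
  change cov[fun z => Y i (fun _ => true) * htWeight G R p true i z -
      Y i (fun _ => false) * htWeight G R p false i z, fun z => Y j (fun _ => true) *
      htWeight G R p true j z - Y j (fun _ => false) * htWeight G R p false j z;
      designLaw G R p] ≤ _
  rw [covariance_contrast MemLp.of_discrete MemLp.of_discrete MemLp.of_discrete
    MemLp.of_discrete, covariance_contrast (hm true i) (hm false i) (hm true j) (hm false j)]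
  have e1 := mul_le_mul_of_nonneg_left (covariance_htWeight_same_le hp0 hp1 G R true h)
    (mul_nonneg (hY i fun _ => true) (hY j fun _ => true))
  have e2 := mul_le_mul_of_nonneg_left (covariance_htWeight_same_le hp0 hp1 G R false h)
    (mul_nonneg (hY i fun _ => false) (hY j fun _ => false))
  have e3 := mul_le_mul_of_nonneg_left (covariance_condWeight_le hp0 hp1 G R h)
    (mul_nonneg (hY i fun _ => true) (hY j fun _ => false))
  have e4 := mul_le_mul_of_nonneg_left (covariance_condWeight_le hp0 hp1 G R h.symm)
    (mul_nonneg (hY i fun _ => false) (hY j fun _ => true))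
  rw [covariance_comm, covariance_comm (X := htWeight G R p true j)] at e4
  linarith

/-- A joint exposure is at most as likely as that of `j`, so same-arm covariances are at most `1/P -
1`, with `P` the exposure probability of `i`. Cross-arm ones are at least `-1`, and their two
contributions of `M ^ 2` cancel the two `-1`s. -/
theorem covariance_htTerm_le {p : ℝ} (hp0 : 0 < p) (hp1 : p < 1) (G : SimpleGraph V)
    (R : Randomization) {Y : V → (V → Bool) → ℝ} {M : ℝ} (hY : ∀ i z, Y i z ∈ Set.Icc 0 M)
    (i j : V) :
    cov[htTerm G R p Y i, htTerm G R p Y j; designLaw G R p] ≤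
      M ^ 2 * ((exposureProb G R p true i)⁻¹ + (exposureProb G R p false i)⁻¹) := by
  have := isProbabilityMeasure_designLaw G R hp0.le hp1.le
  change cov[fun z => Y i (fun _ => true) * htWeight G R p true i z -
      Y i (fun _ => false) * htWeight G R p false i z, fun z => Y j (fun _ => true) *
      htWeight G R p true j z - Y j (fun _ => false) * htWeight G R p false j z;
      designLaw G R p] ≤ _
  rw [covariance_contrast MemLp.of_discrete MemLp.of_discrete MemLp.of_discrete
    MemLp.of_discrete]
  have hsame : ∀ b, Y i (fun _ => b) * Y j (fun _ => b) *
      cov[htWeight G R p b i, htWeight G R p b j; designLaw G R p] ≤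
      M ^ 2 * ((exposureProb G R p b i)⁻¹ - 1) := by
    intro b
    have h1 := exposureProb_pos hp0 hp1 G R b i
    have h2 := exposureProb_pos hp0 hp1 G R b j
    have hle : cov[htWeight G R p b i, htWeight G R p b j; designLaw G R p] ≤
        (exposureProb G R p b i)⁻¹ - 1 := by
      rw [covariance_htWeight hp0 hp1]
      refine sub_le_sub_right ?_ 1
      rw [mul_assoc]
      refine mul_le_of_le_one_right (by positivity) ?_
      rw [inv_mul_le_one₀ h2]
      exact measureReal_mono Set.inter_subset_right
    have hnn : 0 ≤ (exposureProb G R p b i)⁻¹ - 1 := by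
      rw [sub_nonneg, one_le_inv₀ h1]
      exact exposureProb_le_one hp0.le hp1.le G R b i
    refine (mul_le_mul_of_nonneg_left hle
      (mul_nonneg (hY i fun _ => b).1 (hY j fun _ => b).1)).trans ?_
    rw [pow_two]
    exact mul_le_mul_of_nonneg_right (mul_le_mul (hY i _).2 (hY j _).2 (hY j _).1
      ((hY i fun _ => b).1.trans (hY i _).2)) hnn
  have hdiff : ∀ b b', -(Y i (fun _ => b) * Y j (fun _ => b') *
      cov[htWeight G R p b i, htWeight G R p b' j; designLaw G R p]) ≤ M ^ 2 := by
    intro b b'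
    have h1 := exposureProb_pos hp0 hp1 G R b i
    have h2 := exposureProb_pos hp0 hp1 G R b' j
    have hge : -1 ≤ cov[htWeight G R p b i, htWeight G R p b' j; designLaw G R p] := by
      rw [covariance_htWeight hp0 hp1]
      have : 0 ≤ (exposureProb G R p b i)⁻¹ * (exposureProb G R p b' j)⁻¹ *
        (designLaw G R p).real (exposure G b i ∩ exposure G b' j) := by positivity
      linarith
    have hnn := mul_nonneg (hY i fun _ => b).1 (hY j fun _ => b').1
    have h3 : Y i (fun _ => b) * Y j (fun _ => b') ≤ M ^ 2 := by
      rw [pow_two]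
      exact mul_le_mul (hY i _).2 (hY j _).2 (hY j _).1 ((hY i fun _ => b).1.trans (hY i _).2)
    have h4 := mul_le_mul_of_nonneg_left hge hnn
    linarith
  have h1 := hsame true
  have h2 := hsame false
  have h3 := hdiff true false
  have h4 := hdiff false true
  linarith

/-- Far apart nodes contribute little, once every conditional exposure probability is close to
the one for infinitely many clusters. -/
theorem covariance_htTerm_le_of_deficit {p : ℝ} (hp0 : 0 < p) (hp1 : p < 1) (G : SimpleGraph V)
    (R : Randomization) {Y : V → (V → Bool) → ℝ} {M : ℝ} (hY : ∀ i z, Y i z ∈ Set.Icc 0 M)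
    {D : Bool → ℝ} (hD0 : ∀ b, 0 ≤ D b)
    (hD : ∀ b i, ∀ᵐ x ∂seedLaw V, armProb p b ^ labelCount (oneHopMax G x) (ball G 1 i) - D b ≤
      condExposure G R p b i x) {i j : V} (h : Disjoint (ball G 2 i) (ball G 2 j)) :
    cov[htTerm G R p Y i, htTerm G R p Y j; designLaw G R p] ≤
      M ^ 2 * (((exposureProb G R p true i)⁻¹ * D true + (exposureProb G R p false i)⁻¹ * D false) +
        ((exposureProb G R p true j)⁻¹ * D true + (exposureProb G R p false j)⁻¹ * D false)) := by
  refine (covariance_htTerm_le_cond hp0 hp1 G R (fun i z => (hY i z).1) h).trans ?_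
  -- The local approximation: it depends on the seeds only through the cluster count at `i`, not
  -- through the total number of clusters. Truncation at `0` keeps it nonnegative.
  let u : V → Bool → ℕ → ℝ := fun i b k =>
    (exposureProb G R p b i)⁻¹ * max (armProb p b ^ k - D b) 0
  let a : V → Bool → (V → ℝ) → ℝ := fun i b x =>
    u i b (labelCount (oneHopMax G x) (ball G 1 i))
  have hP : ∀ b i, 0 < (exposureProb G R p b i)⁻¹ := fun b i =>
    inv_pos.mpr (exposureProb_pos hp0 hp1 G R b i)
  have hcount : ∀ i, Measurable fun x => labelCount (oneHopMax G x) (ball G 1 i) := fun i =>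
    (measurable_labelCount _).comp (measurable_oneHopMax G)
  have ha : ∀ i b, MemLp (a i b) 2 (seedLaw V) := by
    intro i b
    refine MemLp.of_bound ((measurable_from_nat (f := u i b)).comp
      (hcount i)).aestronglyMeasurable ((exposureProb G R p b i)⁻¹ * 1) (ae_of_all _ fun x => ?_)
    have h1 := armProb_pos hp0 hp1 b
    have h2 : armProb p b ^ labelCount (oneHopMax G x) (ball G 1 i) ≤ 1 :=
      pow_le_one₀ h1.le (armProb_lt_one hp0 hp1 b).le
    rw [Real.norm_of_nonneg (mul_nonneg (hP b i).le (le_max_right _ _))]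
    exact mul_le_mul_of_nonneg_left (max_le (by linarith [hD0 b]) zero_le_one) (hP b i).le
  have ha0 : ∀ i b, ∀ᵐ x ∂seedLaw V, 0 ≤ a i b x := fun i b =>
    ae_of_all _ fun x => mul_nonneg (hP b i).le (le_max_right _ _)
  have haA : ∀ i b, ∀ᵐ x ∂seedLaw V, a i b x ≤ condWeight G R p b i x := fun i b => by
    filter_upwards [hD b i] with x hx
    exact mul_le_mul_of_nonneg_left (max_le hx measureReal_nonneg) (hP b i).le
  have hAr : ∀ i b, ∀ᵐ x ∂seedLaw V, condWeight G R p b i x ≤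
      a i b x + (exposureProb G R p b i)⁻¹ * D b := fun i b => ae_of_all _ fun x => by
    simp only [a, u, condWeight]
    rw [← mul_add]
    refine mul_le_mul_of_nonneg_left ?_ (hP b i).le
    rw [condExposure_eq hp0.le hp1.le]
    have h1 := (inclusionSeq_armSeq hp0.le hp1.le (labelCount_pos (c := oneHopMax G x)
      (A := Finset.univ) ⟨i, Finset.mem_univ i⟩) R b).le_pow
      (labelCount_mono (oneHopMax G x) (Finset.subset_univ (ball G 1 i)))
    have h2 := le_max_left (armProb p b ^ labelCount (oneHopMax G x) (ball G 1 i) - D b) 0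
    linarith
  refine covariance_contrast_le_of_approx (A := fun b => condWeight G R p b i) (a := a i)
    (B := fun b => condWeight G R p b j) (b := a j) (α := fun b => Y i fun _ => b)
    (β := fun b => Y j fun _ => b) (r := fun b => (exposureProb G R p b i)⁻¹ * D b)
    (s := fun b => (exposureProb G R p b j)⁻¹ * D b)
    (fun b => memLp_condWeight hp0.le hp1.le G R b i) (ha i)
    (fun b => memLp_condWeight hp0.le hp1.le G R b j) (ha j) (ha0 i) (haA i) (hAr i)
    (ha0 j) (haA j) (hAr j) (fun b => (integral_condWeight hp0 hp1 G R b i).le)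
    (fun b => (integral_condWeight hp0 hp1 G R b j).le) (fun b => hY i _) (fun b => hY j _) ?_
  intro b b'
  exact ((indepFun_labelCount h).comp (measurable_from_nat (f := u i b))
    (measurable_from_nat (f := u j b'))).covariance_eq_zero (ha i b) (ha j b')

/-- With at least `K₀ ≥ 2` clusters, far apart nodes contribute a `1 / (K₀ - 1)` fraction of the
bound for nearby nodes. -/
theorem covariance_htTerm_le_div {p : ℝ} (hp0 : 0 < p) (hp1 : p < 1) (G : SimpleGraph V)
    (R : Randomization) {Y : V → (V → Bool) → ℝ} {M : ℝ} (hY : ∀ i z, Y i z ∈ Set.Icc 0 M)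
    {K₀ : ℕ} (hK₀ : 2 ≤ K₀)
    (hK : ∀ᵐ x ∂seedLaw V, K₀ ≤ labelCount (oneHopMax G x) Finset.univ) {Δ : ℝ}
    (hΔ : ∀ i, ((ball G 2 i).card : ℝ) ≤ Δ) {i j : V}
    (h : Disjoint (ball G 2 i) (ball G 2 j)) :
    cov[htTerm G R p Y i, htTerm G R p Y j; designLaw G R p] ≤
      M ^ 2 * (Δ * (p⁻¹ + (1 - p)⁻¹) / (K₀ - 1)) := by
  obtain ⟨C₁, C₀, hC, h1, h2, h3, h4⟩ := exists_deficit_bounds hp0 hp1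
  have hp' : 0 < 1 - p := by linarith
  have hK1 : (0 : ℝ) < (K₀ : ℝ) - 1 := by
    have : (2 : ℝ) ≤ K₀ := by exact_mod_cast hK₀
    linarith
  let C : Bool → ℝ := fun b => if b then C₁ else C₀
  have hCb : ∀ b, armProb p b * (1 - armProb p b) ^ 2 ≤ C b ∧
      ∀ k : ℕ, 2 ≤ k → k * armProb p b ^ k * (1 - armProb p b) ≤ C b := by
    rintro (_ | _)
    · simpa [armProb, C] using ⟨h3, h4⟩
    · simpa [armProb, C] using ⟨h1, h2⟩
  have hCnn : ∀ b, 0 ≤ C b := fun b => by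
    have := armProb_pos hp0 hp1 b
    exact le_trans (by positivity) (hCb b).1
  let D : Bool → ℝ := fun b => C b / ((K₀ - 1) * (1 - armProb p b))
  have hden : ∀ b, 0 < ((K₀ : ℝ) - 1) * (1 - armProb p b) := fun b =>
    mul_pos hK1 (sub_pos.mpr (armProb_lt_one hp0 hp1 b))
  have hD0 : ∀ b, 0 ≤ D b := fun b => div_nonneg (hCnn b) (hden b).le
  have hD : ∀ b i, ∀ᵐ x ∂seedLaw V,
      armProb p b ^ labelCount (oneHopMax G x) (ball G 1 i) - D b ≤
        condExposure G R p b i x := by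
    intro b i
    filter_upwards [hK] with x hx
    rw [condExposure_eq hp0.le hp1.le]
    set K := labelCount (oneHopMax G x) Finset.univ
    have hlow := (inclusionSeq_armSeq hp0.le hp1.le (by omega : 1 ≤ K) R b).pow_sub_le
      (armProb_pos hp0 hp1 b) (armProb_lt_one hp0 hp1 b) (hK₀.trans hx) (hCb b).1 (hCb b).2
      (labelCount_mono (oneHopMax G x) (Finset.subset_univ (ball G 1 i)))
    have hKK : (K₀ : ℝ) ≤ K := by exact_mod_cast hx
    have : C b / ((K - 1) * (1 - armProb p b)) ≤ D b :=
      div_le_div_of_nonneg_left (hCnn b) (hden b) (mul_le_mul_of_nonneg_right (by linarith)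
        (sub_nonneg.mpr (armProb_lt_one hp0 hp1 b).le))
    linarith
  refine (covariance_htTerm_le_of_deficit hp0 hp1 G R hY hD0 hD h).trans ?_
  have hΔ0 : 0 ≤ Δ := (Nat.cast_nonneg _).trans (hΔ i)
  have hinv : ∀ b i, (exposureProb G R p b i)⁻¹ ≤ Δ * (armProb p b)⁻¹ := fun b i => by
    have e1 := armProb_le_card_mul_exposureProb hp0.le hp1.le G R b i
    have e2 := exposureProb_pos hp0 hp1 G R b i
    have e3 := armProb_pos hp0 hp1 b
    rw [← div_eq_mul_inv, le_div_iff₀ e3, inv_mul_le_iff₀ e2, mul_comm]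
    exact e1.trans (mul_le_mul_of_nonneg_right (hΔ i) e2.le)
  have hsum : ∀ i, (exposureProb G R p true i)⁻¹ * D true +
      (exposureProb G R p false i)⁻¹ * D false ≤
      Δ * (p⁻¹ + (1 - p)⁻¹) / (K₀ - 1) / 2 := by
    intro i
    refine (add_le_add (mul_le_mul_of_nonneg_right (hinv true i) (hD0 true))
      (mul_le_mul_of_nonneg_right (hinv false i) (hD0 false))).trans ?_
    -- Both arms carry the factor `1 / (p (1 - p)) = 1 / p + 1 / (1 - p)`. The budget `C₁ + C₀ ≤ 1 /
    -- 2` then leaves half of the bound for each of `i` and `j`.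
    have e : Δ * (armProb p true)⁻¹ * D true + Δ * (armProb p false)⁻¹ * D false =
        Δ * (p⁻¹ + (1 - p)⁻¹) / (K₀ - 1) * (C₁ + C₀) := by
      simp only [D, C, armProb, if_true, Bool.false_eq_true, if_false, sub_sub_cancel]
      field_simp
      ring
    rw [e, div_eq_mul_inv _ (2 : ℝ)]
    refine mul_le_mul_of_nonneg_left (by linarith) ?_
    positivity
  refine mul_le_mul_of_nonneg_left ?_ (sq_nonneg M)
  linarith [hsum i, hsum j]

end

end RGCR

end

/-! ### Summation over all pairs of nodes -/

theorem mainTheorem1 {V : Type*} [Fintype V] (G : SimpleGraph V) [DecidableRel G.Adj]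
    (κ : ℝ) (hκ : RGCR.RestrictedGrowth G κ)
    (p : ℝ) (hp0 : 0 < p) (hp1 : p < 1)
    (Ybar : ℝ) (Y : V → (V → Bool) → ℝ) (hmodel : RGCR.ExposureModel G Y)
    (hY : ∀ (i : V) (z : V → Bool), Y i z ∈ Set.Icc 0 Ybar)
    (R : RGCR.Randomization) :
    ProbabilityTheory.variance (RGCR.htGATE G R p Y) (RGCR.designLaw G R p) ≤
      2 / (Fintype.card V : ℝ) *
        (Ybar ^ 2 * ((G.maxDegree : ℝ) + 1) ^ 2 * κ ^ 4 * (p⁻¹ + (1 - p)⁻¹)) := by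
  classical
  have hprob := RGCR.isProbabilityMeasure_designLaw G R hp0.le hp1.le
  have hp' : 0 < 1 - p := by linarith
  rw [RGCR.htGATE_eq G R p hmodel, variance_const_mul,
    variance_fun_sum fun i => MemLp.of_discrete]
  -- Without nodes both sides are `0`, as division by zero gives `0`; `1 ≤ κ` requires a node.
  rcases isEmpty_or_nonempty V with hV | hV
  · simp
  have hκ1 := hκ.one_le
  set n : ℝ := (Fintype.card V : ℝ) with hn
  have hn0 : 0 < n := Nat.cast_pos.mpr Fintype.card_pos
  set d : ℝ := (G.maxDegree : ℝ) + 1 with hd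
  have hd0 : 0 < d := by positivity
  set Q := p⁻¹ + (1 - p)⁻¹ with hQ
  have hQ0 : 0 < Q := by positivity
  set T := κ ^ 3 * d with hT
  have hκ3 : 1 ≤ κ ^ 3 := one_le_pow₀ hκ1
  have hTd : d ≤ T := le_mul_of_one_le_left hd0.le hκ3
  set Δ := κ * d with hΔ
  have hΔ0 : 0 < Δ := by positivity
  have hball2 : ∀ i, ((RGCR.ball G 2 i).card : ℝ) ≤ Δ := fun i => by
    simpa using hκ.card_ball_le i 1
  have hball4 : ∀ i, ((RGCR.ball G 4 i).card : ℝ) ≤ T := fun i => hκ.card_ball_le i 3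
  have hnear : ∀ i j, cov[RGCR.htTerm G R p Y i, RGCR.htTerm G R p Y j;
      RGCR.designLaw G R p] ≤ Ybar ^ 2 * (Δ * Q) := by
    intro i j
    refine (RGCR.covariance_htTerm_le hp0 hp1 G R hY i j).trans
      (mul_le_mul_of_nonneg_left ?_ (sq_nonneg _))
    have hinv : ∀ b, (RGCR.exposureProb G R p b i)⁻¹ ≤ Δ * (RGCR.armProb p b)⁻¹ := fun b => by
      have e1 := RGCR.armProb_le_card_mul_exposureProb hp0.le hp1.le G R b i
      have e2 := RGCR.exposureProb_pos hp0 hp1 G R b i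
      have e3 := RGCR.armProb_pos hp0 hp1 b
      rw [← div_eq_mul_inv, le_div_iff₀ e3, inv_mul_le_iff₀ e2, mul_comm]
      exact e1.trans (mul_le_mul_of_nonneg_right (hball2 i) e2.le)
    rw [hQ, mul_add]
    exact add_le_add (hinv true) (hinv false)
  have hrow : ∀ i, ∑ j, cov[RGCR.htTerm G R p Y i, RGCR.htTerm G R p Y j;
      RGCR.designLaw G R p] ≤ Ybar ^ 2 * (2 * T * (Δ * Q)) := by
    intro i
    set K₀ := ⌈n / d⌉₊ with hK₀
    have hnK : n ≤ K₀ * d := (div_le_iff₀ hd0).mp (Nat.le_ceil _)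
    have hc : 0 ≤ Ybar ^ 2 * (Δ * Q) := by positivity
    -- The far bound needs `K₀ ≥ 2`. Otherwise `n ≤ d ≤ T`, and the near bound for all `n` pairs is
    -- enough.
    rcases le_or_gt K₀ 1 with hle | hgt
    · have hnd : n ≤ d := hnK.trans (mul_le_of_le_one_left hd0.le (by exact_mod_cast hle))
      calc _ ≤ ∑ _j : V, Ybar ^ 2 * (Δ * Q) := Finset.sum_le_sum fun j _ => hnear i j
        _ = n * (Ybar ^ 2 * (Δ * Q)) := by simp [hn]
        _ ≤ (2 * T) * (Ybar ^ 2 * (Δ * Q)) :=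
            mul_le_mul_of_nonneg_right (by linarith) hc
        _ = _ := by ring
    · have hK : ∀ᵐ x ∂(RGCR.seedLaw V),
          K₀ ≤ RGCR.labelCount (RGCR.oneHopMax G x) Finset.univ := by
        filter_upwards [RGCR.ae_injective_seedLaw] with x hx
        rw [hK₀, Nat.ceil_le, div_le_iff₀ hd0]
        rw [hn, hd]
        exact_mod_cast RGCR.card_le_labelCount_mul (G := G) hx
      have hK2 : (2 : ℝ) ≤ K₀ := by exact_mod_cast hgt
      have hK1 : (0 : ℝ) < K₀ - 1 := by linarith
      have hterm : ∀ j, cov[RGCR.htTerm G R p Y i, RGCR.htTerm G R p Y j;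
          RGCR.designLaw G R p] ≤ Ybar ^ 2 * (Δ * Q) / (K₀ - 1) +
          if j ∈ RGCR.ball G 4 i then
            Ybar ^ 2 * (Δ * Q) - Ybar ^ 2 * (Δ * Q) / (K₀ - 1) else 0 := by
        intro j
        split_ifs with hj
        · linarith [hnear i j]
        · have := RGCR.covariance_htTerm_le_div hp0 hp1 G R hY hgt hK hball2
            (RGCR.disjoint_ball (r := 2) (s := 2) hj)
          rw [add_zero]
          refine this.trans (le_of_eq ?_)
          ring
      set c := Ybar ^ 2 * (Δ * Q)
      calc _ ≤ ∑ j, (c / (K₀ - 1) + if j ∈ RGCR.ball G 4 i then c - c / (K₀ - 1) else 0) :=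
            Finset.sum_le_sum fun j _ => hterm j
        _ = n * (c / (K₀ - 1)) + (RGCR.ball G 4 i).card * (c - c / (K₀ - 1)) := by
            rw [Finset.sum_add_distrib, Finset.sum_ite_mem]
            simp only [Finset.sum_const, Finset.card_univ, Finset.univ_inter, nsmul_eq_mul, hn]
        _ ≤ (K₀ * T) * (c / (K₀ - 1)) + T * (c - c / (K₀ - 1)) := by
            have hdiv : c / (K₀ - 1) ≤ c := div_le_self hc (by linarith)
            have hdiv0 : 0 ≤ c / (K₀ - 1) := by positivity
            refine add_le_add (mul_le_mul_of_nonneg_right ?_ hdiv0)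
              (mul_le_mul_of_nonneg_right (hball4 i) (by linarith))
            exact hnK.trans (mul_le_mul_of_nonneg_left hTd (Nat.cast_nonneg _))
        -- The factor `2` is exact: `K₀ / (K₀ - 1) + 1 - 1 / (K₀ - 1) = 2`.
        _ = Ybar ^ 2 * (2 * T * (Δ * Q)) := by
            field_simp
            ring
  calc (1 / n) ^ 2 * ∑ i, ∑ j, cov[RGCR.htTerm G R p Y i, RGCR.htTerm G R p Y j;
        RGCR.designLaw G R p]
      ≤ (1 / n) ^ 2 * ∑ _i : V, Ybar ^ 2 * (2 * T * (Δ * Q)) :=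
        mul_le_mul_of_nonneg_left (Finset.sum_le_sum fun i _ => hrow i) (by positivity)
    _ = (1 / n) ^ 2 * (n * (Ybar ^ 2 * (2 * T * (Δ * Q)))) := by simp [hn]
    _ = 2 / n * (Ybar ^ 2 * d ^ 2 * κ ^ 4 * Q) := by
        rw [hT, hΔ]
        field_simp
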